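/- Let $\varphi:\mathbb{C}\to\mathbb{R}$ be a non-negative, radially symmetric function ($\varphi(z)=\varphi(|z|)$) of class $\mathscr{C}^2$ such that, for some $\delta>0$, $\varphi(z)\ge(1+\delta)\log|z|$ for all sufficiently large $|z|$. Let $L(\mathbb{C})$ be the class of subharmonic functions $u:\mathbb{C}\to[-\infty,\infty)$ such that $u(z)-\log|z|$ is bounded above as $|z|\to\infty$, let $$U_\varphi(z):=\sup\{u(z): u\in L(\mathbb{C}),\ u\le\varphi \text{ on } \mathbb{C}\}$$ be the equilibrium potential, and let $\mu_e:=\frac{1}{2\pi}\Delta U_\varphi$ (Laplacian in the sense of distributions, which is a measure) be the weighted equilibrium measure. Put $$c_j^n:=\Big(\int_{\mathbb{C}}|z|^{2j}e^{-2n\varphi(z)}\,dz\Big)^{-1/2},\qquad f_n(z)=\sum_{j=0}^n a_j^n c_j^n z^j,$$ where $dz$ is Lebesgue measure on $\mathbb{C}$ (the integrals are finite for all large $n$) and $a_0^n,\dots,a_n^n$ are independent standard real Gaussian random variables; $\mathrm{Prob}_n$ denotes their joint law. For $U\subset\mathbb{C}$ let $\mathcal{N}_U(f_n)$ be the number of complex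 zeros of $f_n$ in $U$, counted with multiplicity. **Theorem 2.4.** Let $\varepsilon>0$ and let $U\subset\mathbb{C}$ be a bounded set (for instance a relatively compact open set) whose boundary $\partial U$ has zero Lebesgue measure. Then there are a constant $C_{U,\varepsilon}>0$, depending only on $\varphi$, $U$ and $\varepsilon$, and an $n_0$ such that for all $n\ge n_0$ $$\mathrm{Prob}_n\Big[\,\Big|\tfrac1n\mathcal{N}_U(f_n)-\tfrac{1}{2\pi}\int_U\Delta U_\varphi\Big|>\varepsilon\Big]\le\exp(-C_{U,\varepsilon}\,n),$$ where $\frac{1}{2\pi}\int_U\Delta U_\varphi=\mu_e(U)$. -/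

import Mathlib

open scoped ContDiff Topology

namespace RandomPoly

/-! ### Potential theory in the plane -/

/-- A function `u : ℂ → [-∞, ∞)` is subharmonic on `ℂ` if it is upper semicontinuous and satisfies
the sub-mean value inequality `u c ≤ (1/2π) ∫ u (c + r e^{iθ}) dθ` on every circle. As `u` is upper
semicontinuous and bounded above on the circle, its mean over the circle (possibly `-∞`) is the
infimum of the means of the continuous functions `g` that lie above `u` on the circle; the
inequality is expressed in this way. (The function `-∞` is allowed.) -/
structure IsSubharmonic (u : ℂ → EReal) : Prop where
  usc : UpperSemicontinuous u
  ne_top : ∀ z, u z ≠ ⊤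
  le_mean : ∀ (c : ℂ) (r : ℝ), 0 < r → ∀ g : ℂ → ℝ, Continuous g →
    (∀ z ∈ Metric.sphere c r, u z ≤ (g z : EReal)) →
      u c ≤ ((Real.circleAverage g c r : ℝ) : EReal)

/-- The Lelong class `L(ℂ)`: subharmonic functions `u` on `ℂ` such that `u z - log |z|` is bounded
above as `|z| → ∞`. -/
def LelongClass : Set (ℂ → EReal) :=
  {u | IsSubharmonic u ∧
    ∃ C : ℝ, ∀ᶠ z in Bornology.cobounded ℂ, u z ≤ ((Real.log ‖z‖ + C : ℝ) : EReal)}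

/-- The equilibrium potential `U_φ z = sup {u z : u ∈ L(ℂ), u ≤ φ on ℂ}`. Only the finite values
`u z` enter; the set below is bounded above by `φ z`. -/
noncomputable def equilibriumPotential (φ : ℂ → ℝ) (z : ℂ) : ℝ :=
  sSup {x : ℝ | ∃ u ∈ LelongClass, (∀ w, u w ≤ (φ w : EReal)) ∧ u z = (x : EReal)}

/-- The (Radon) measure `μ` is the Laplacian of the locally integrable function `u` in the sense of
distributions: `∫ ψ dμ = ∫ u Δψ dλ` for every test function `ψ`. -/
structure IsDistribLaplacian (u : ℂ → ℝ) (μ : MeasureTheory.Measure ℂ) : Prop where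
  locallyIntegrable : MeasureTheory.LocallyIntegrable u
  locallyFinite : MeasureTheory.IsLocallyFiniteMeasure μ
  integral_eq : ∀ ψ : ℂ → ℝ, ContDiff ℝ ∞ ψ → HasCompactSupport ψ →
    ∫ z, ψ z ∂μ = ∫ z, u z * Laplacian.laplacian ψ z

open MeasureTheory in
/-- The inequality behind the uniqueness of the measure that represents a distribution. -/
theorem measure_le_of_testFunctions {μ ν : Measure ℂ}
    [IsLocallyFiniteMeasure μ] [IsLocallyFiniteMeasure ν]
    (h : ∀ ψ : ℂ → ℝ, ContDiff ℝ ∞ ψ → HasCompactSupport ψ → ∫ z, ψ z ∂μ = ∫ z, ψ z ∂ν)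
    {V : Set ℂ} (hV : IsOpen V) : μ V ≤ ν V := by
  rw [hV.measure_eq_iSup_isCompact]
  refine iSup_le fun K => iSup_le fun hKV => iSup_le fun hK => ?_
  obtain ⟨W, hW, hKW, hWV, hWc⟩ := exists_open_between_and_isCompact_closure hK hV hKV
  obtain ⟨ψ, hd, hr, hs, h1⟩ := exists_contMDiff_support_eq_eq_one_iff
    (modelWithCornersSelf ℝ ℂ) (n := (⊤ : ℕ∞)) hW hK.isClosed hKW
  have hd' : ContDiff ℝ ∞ ψ := hd.contDiff
  have hc : HasCompactSupport ψ := by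
    unfold HasCompactSupport tsupport
    rwa [hs]
  have h0 : ∀ z, 0 ≤ ψ z := fun z => (hr ⟨z, rfl⟩).1
  have hle : ∀ z, ψ z ≤ 1 := fun z => (hr ⟨z, rfl⟩).2
  have hμi : Integrable ψ μ := hd'.continuous.integrable_of_hasCompactSupport hc
  have hνi : Integrable ψ ν := hd'.continuous.integrable_of_hasCompactSupport hc
  calc μ K = ∫⁻ z, K.indicator 1 z ∂μ := (lintegral_indicator_one hK.measurableSet).symm
    _ ≤ ∫⁻ z, ENNReal.ofReal (ψ z) ∂μ := by
        refine lintegral_mono fun z => ?_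
        by_cases hz : z ∈ K
        · simp [hz, (h1 z).1 hz]
        · simp [hz]
    _ = ∫⁻ z, ENNReal.ofReal (ψ z) ∂ν := by
        rw [← ofReal_integral_eq_lintegral_ofReal hμi (Filter.Eventually.of_forall h0),
          ← ofReal_integral_eq_lintegral_ofReal hνi (Filter.Eventually.of_forall h0),
          h ψ hd' hc]
    _ ≤ ∫⁻ z, V.indicator 1 z ∂ν := by
        refine lintegral_mono fun z => ?_
        by_cases hz : z ∈ V
        · simp [hz, hle z]
        · have : ψ z = 0 := by
            by_contra hne
            have hzW : z ∈ W := hs ▸ (Function.mem_support.2 hne)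
            exact hz (hWV (subset_closure hzW))
          simp [this]
    _ = ν V := lintegral_indicator_one hV.measurableSet

/-- A function has at most one Laplacian measure. -/
theorem IsDistribLaplacian.unique {u : ℂ → ℝ} {μ ν : MeasureTheory.Measure ℂ}
    (hμ : IsDistribLaplacian u μ) (hν : IsDistribLaplacian u ν) : μ = ν := by
  have := hμ.locallyFinite
  have := hν.locallyFinite
  have h : ∀ ψ : ℂ → ℝ, ContDiff ℝ ∞ ψ → HasCompactSupport ψ → ∫ z, ψ z ∂μ = ∫ z, ψ z ∂ν :=
    fun ψ h1 h2 => (hμ.integral_eq ψ h1 h2).trans (hν.integral_eq ψ h1 h2).symm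
  refine MeasureTheory.Measure.OuterRegular.ext_isOpen fun V hV => le_antisymm
    (measure_le_of_testFunctions h hV)
    (measure_le_of_testFunctions (fun ψ h1 h2 => (h ψ h1 h2).symm) hV)

open Classical in
/-- The distributional Laplacian `Δu` as a measure (it is unique by `IsDistribLaplacian.unique`);
the value is `0` if `Δu` is not a measure. -/
noncomputable def laplacianMeasure (u : ℂ → ℝ) : MeasureTheory.Measure ℂ :=
  if h : ∃ μ, IsDistribLaplacian u μ then h.choose else 0

/-- The weighted equilibrium measure `μ_e = (1/2π) ΔU_φ`. -/
noncomputable def equilibriumMeasure (φ : ℂ → ℝ) : MeasureTheory.Measure ℂ :=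
  ENNReal.ofReal (1 / (2 * Real.pi)) • laplacianMeasure (equilibriumPotential φ)

/-! ### Random polynomials -/

/-- The normalizing constant `c_j^n = (∫ |z|^{2j} e^{-2nφ(z)} dz)^{-1/2}`. -/
noncomputable def normConst (φ : ℂ → ℝ) (n j : ℕ) : ℝ :=
  (∫ z : ℂ, ‖z‖ ^ (2 * j) * Real.exp (-2 * n * φ z)) ^ (-(1 / 2) : ℝ)

/-- The polynomial `f_n(z) = ∑_{j=0}^n a_j c_j^n z^j` with real coefficient vector `a`. -/
noncomputable def randPoly (φ : ℂ → ℝ) (n : ℕ) (a : Fin (n + 1) → ℝ) : Polynomial ℂ :=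
  ∑ j : Fin (n + 1), Polynomial.monomial (j : ℕ) ((a j * normConst φ n j : ℝ) : ℂ)

/-- `Prob_n`: the law of a vector of `n + 1` independent standard real Gaussians. -/
noncomputable def gaussianProb (n : ℕ) : MeasureTheory.Measure (Fin (n + 1) → ℝ) :=
  MeasureTheory.Measure.pi fun _ => ProbabilityTheory.gaussianReal 0 1

open Classical in
/-- The number of complex zeros of `p` in `U`, counted with multiplicity. -/
noncomputable def zeroCount (p : Polynomial ℂ) (U : Set ℂ) : ℕ :=
  p.roots.countP (· ∈ U)

end RandomPoly

/-!
The zeros of `f_n` are read off from the potential `u_n = (1 / n) log |f_n|`, because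
`(1 / 2π) Δ u_n` is the normalized zero counting measure, and it suffices that `u_n` is close to
`U_φ` in `L¹` on a large disc, outside an event of exponentially small probability.

*Potential theory.* For a radial weight, `U_φ` is, as a function of `log |z|`, the largest convex
minorant of `φ` with slopes in `[0, 1]` (`exists_supporting_line`). This follows from the maximum
principle on annuli, which bounds every competitor by the lines through two points of the graph of
`φ`. Hence `U_φ` is continuous. Its circle averages, lowered by `M r ^ 2`, are again competitors, so
that `0 ≤ A_r U_φ - U_φ ≤ M r ^ 2`. As the distributional Laplacian is the limit of
`4 (A_r - 1) / r ^ 2` (`tendsto_integral_circleAverage_sub`), it is a measure with bounded density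
(`exists_isDistribLaplacian`). In particular `μ_e` does not charge the boundary of `U`. The same
limit gives `Δ log |z - a| = 2π δ_a`.

*Probability.* A Laplace-type estimate of the integrals gives `c_j^n = exp (n (β(j / n) + o(1)))`
uniformly in `j`, where `s log |z| + β(s)` is the highest line of slope `s` below `φ`. So every term
`c_j^n |z| ^ j` is at most `exp (n (U_φ z + o(1)))`, and at each point some term attains this bound.
As Gaussian coefficients larger than `exp (η n)` are unlikely, `u_n ≤ U_φ + η` everywhere. By
anti-concentration of a single coefficient, `u_n ≥ U_φ - η` at finitely many given points
(`eventually_gaussianProb_compl_le`).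

*Conclusion.* The sub-mean value property of `u_n` on discs about the points of a fine grid turns
these two bounds into an `L¹` bound (`exists_grid`). Pairing `u_n - U_φ` with the Laplacians of smooth
functions that sandwich the indicator of `U` finishes the proof (`abs_sum_roots_sub_le`).
-/

/-! ### Circle averages and the Laplacian -/

section LaplacianMean

open MeasureTheory Filter Real Metric

/-- The symmetric second difference of a `C²` function is quadratically small, uniformly on
bounded sets. -/
theorem exists_abs_second_difference_le {f : ℂ → ℝ} (hf : ContDiff ℝ 2 f) (R : ℝ) :
    ∃ M : ℝ, 0 ≤ M ∧ ∀ z ∈ closedBall (0 : ℂ) R, ∀ h : ℂ, ‖h‖ ≤ 1 →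
      |f (z + h) + f (z - h) - 2 * f z| ≤ M * ‖h‖ ^ 2 := by
  have hf1 : ContDiff ℝ 1 (fderiv ℝ f) := hf.fderiv_right (by norm_num)
  have hfd : Differentiable ℝ f := hf.differentiable (by norm_num)
  have hc : Continuous fun x => ‖fderiv ℝ (fderiv ℝ f) x‖ :=
    continuous_norm.comp (hf1.continuous_fderiv (by norm_num))
  obtain ⟨L, hL⟩ : ∃ L, ∀ x ∈ closedBall (0 : ℂ) (R + 1), ‖fderiv ℝ (fderiv ℝ f) x‖ ≤ L := by
    obtain ⟨L, hL⟩ := ((isCompact_closedBall (0 : ℂ) (R + 1)).image hc).bddAbove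
    exact ⟨L, fun x hx => hL ⟨x, hx, rfl⟩⟩
  have hL' : ∀ x ∈ closedBall (0 : ℂ) (R + 1), ∀ y ∈ closedBall (0 : ℂ) (R + 1),
      ‖fderiv ℝ f y - fderiv ℝ f x‖ ≤ L * ‖y - x‖ := fun x hx y hy =>
    (convex_closedBall (0 : ℂ) (R + 1)).norm_image_sub_le_of_norm_fderiv_le
      (fun w _ => (hf1.differentiable (by norm_num)) w) hL hx hy
  refine ⟨|L| * 2, by positivity, fun z hz h hh => ?_⟩
  rw [mem_closedBall_zero_iff] at hz
  have hmem : ∀ t ∈ Set.Icc (0 : ℝ) 1, ∀ s : ℝ, |s| = t →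
      z + s • h ∈ closedBall (0 : ℂ) (R + 1) := by
    intro t ht s hs
    rw [mem_closedBall_zero_iff]
    refine (norm_add_le _ _).trans ?_
    rw [norm_smul, Real.norm_eq_abs, hs]
    have : t * ‖h‖ ≤ 1 := mul_le_one₀ ht.2 (norm_nonneg _) hh
    linarith
  have hder : ∀ t : ℝ, HasDerivAt (fun t : ℝ => f (z + t • h) + f (z - t • h))
      (fderiv ℝ f (z + t • h) h + fderiv ℝ f (z - t • h) (-h)) t := by
    intro t
    have h1 : HasDerivAt (fun t : ℝ => z + t • h) h t := by
      simpa using ((hasDerivAt_id t).smul_const h).const_add z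
    have h2 : HasDerivAt (fun t : ℝ => z - t • h) (-h) t := by
      simpa using ((hasDerivAt_id t).smul_const h).const_sub z
    exact ((hfd _).hasFDerivAt.comp_hasDerivAt t h1).add
      ((hfd _).hasFDerivAt.comp_hasDerivAt t h2)
  have key := (convex_Icc (0 : ℝ) 1).norm_image_sub_le_of_norm_hasDerivWithin_le
    (C := |L| * 2 * ‖h‖ ^ 2) (fun t _ => (hder t).hasDerivWithinAt) ?_
    (Set.left_mem_Icc.2 zero_le_one) (Set.right_mem_Icc.2 zero_le_one)
  · simp only [one_smul, zero_smul, add_zero, sub_zero, norm_one, mul_one, Real.norm_eq_abs] at key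
    rwa [← two_mul] at key
  · intro t ht
    rw [map_neg, ← sub_eq_add_neg, ← sub_apply]
    refine (ContinuousLinearMap.le_opNorm _ _).trans ?_
    have hneg := hmem t ht (-t) (by rw [abs_neg, abs_of_nonneg ht.1])
    rw [neg_smul, ← sub_eq_add_neg] at hneg
    have hm' := hL' _ hneg _ (hmem t ht t (abs_of_nonneg ht.1))
    have e : z + t • h - (z - t • h) = (2 * t) • h := by
      rw [mul_smul, two_smul]; abel
    rw [e, norm_smul, Real.norm_eq_abs, abs_of_nonneg (by linarith [ht.1])] at hm'
    calc _ ≤ (L * (2 * t * ‖h‖)) * ‖h‖ := by gcongr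
      _ ≤ (|L| * (2 * 1 * ‖h‖)) * ‖h‖ := by
        have := ht.1
        have := ht.2
        gcongr
        exact le_abs_self L
      _ = _ := by ring

theorem tendsto_second_difference {f : ℂ → ℝ} (hf : ContDiff ℝ 2 f) (z ζ : ℂ) :
    Tendsto (fun r : ℝ => (f (z + r • ζ) + f (z - r • ζ) - 2 * f z) / r ^ 2) (𝓝[>] 0)
      (𝓝 (fderiv ℝ (fderiv ℝ f) z ζ ζ)) := by
  have hf1 : ContDiff ℝ 1 (fderiv ℝ f) := hf.fderiv_right (by norm_num)
  have hfd : Differentiable ℝ f := hf.differentiable (by norm_num)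
  have hfd1 : Differentiable ℝ (fderiv ℝ f) := hf1.differentiable (by norm_num)
  have h1 : ∀ t : ℝ, HasDerivAt (fun t : ℝ => z + t • ζ) ζ t := fun t => by
    simpa using ((hasDerivAt_id t).smul_const ζ).const_add z
  have h2 : ∀ t : ℝ, HasDerivAt (fun t : ℝ => z - t • ζ) (-ζ) t := fun t => by
    simpa using ((hasDerivAt_id t).smul_const ζ).const_sub z
  have hder : ∀ t : ℝ, HasDerivAt (fun t : ℝ => f (z + t • ζ) + f (z - t • ζ) - 2 * f z)
      (fderiv ℝ f (z + t • ζ) ζ + fderiv ℝ f (z - t • ζ) (-ζ)) t := fun t =>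
    (((hfd _).hasFDerivAt.comp_hasDerivAt t (h1 t)).add
      ((hfd _).hasFDerivAt.comp_hasDerivAt t (h2 t))).sub_const _
  -- the derivative of the numerator vanishes at `0`, with derivative `2 D²f(ζ, ζ)` there
  have hder2 : HasDerivAt (fun t : ℝ => fderiv ℝ f (z + t • ζ) ζ + fderiv ℝ f (z - t • ζ) (-ζ))
      (2 * fderiv ℝ (fderiv ℝ f) z ζ ζ) 0 := by
    have hG : ∀ v w : ℂ, HasFDerivAt (fun w => fderiv ℝ f w v)
        ((ContinuousLinearMap.apply ℝ ℝ v).comp (fderiv ℝ (fderiv ℝ f) w)) w := fun v w =>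
      (ContinuousLinearMap.apply ℝ ℝ v).hasFDerivAt.comp w (hfd1 w).hasFDerivAt
    have a1 := (hG ζ (z + (0 : ℝ) • ζ)).comp_hasDerivAt (0 : ℝ) (h1 0)
    have a2 := (hG (-ζ) (z - (0 : ℝ) • ζ)).comp_hasDerivAt (0 : ℝ) (h2 0)
    have a3 := a1.add a2
    refine a3.congr_deriv ?_
    simp only [zero_smul, add_zero, sub_zero, ContinuousLinearMap.comp_apply,
      ContinuousLinearMap.apply_apply, map_neg, neg_apply, neg_neg]
    ring
  refine HasDerivAt.lhopital_zero_nhdsGT (Eventually.of_forall fun t => hder t)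
    (g' := fun t => 2 * t) ?_ ?_ ?_ ?_ ?_
  · exact Eventually.of_forall fun t => by simpa using hasDerivAt_pow 2 t
  · filter_upwards [self_mem_nhdsWithin] with t ht
    have : (0 : ℝ) < t := ht
    positivity
  · have := (hder 0).continuousAt.tendsto
    simp only [zero_smul, add_zero, sub_zero] at this
    rw [← two_mul, sub_self] at this
    exact this.mono_left nhdsWithin_le_nhds
  · have : Tendsto (fun t : ℝ => t ^ 2) (𝓝 0) (𝓝 (0 ^ 2)) := (continuous_pow 2).tendsto 0
    simp only [ne_eq, OfNat.ofNat_ne_zero, not_false_eq_true, zero_pow] at this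
    exact this.mono_left nhdsWithin_le_nhds
  · have := (hasDerivAt_iff_tendsto_slope.1 hder2).mono_left
      (nhdsWithin_mono 0 (fun x hx => ne_of_gt hx : Set.Ioi (0 : ℝ) ⊆ {0}ᶜ))
    have h3 := this.div_const 2
    rw [mul_div_cancel_left₀ _ two_ne_zero] at h3
    refine h3.congr fun t => ?_
    simp [slope_def_field]
    rw [div_div, mul_comm t]

theorem trace_rotation (B : ℂ →L[ℝ] ℂ →L[ℝ] ℝ) {ζ : ℂ} (hζ : ‖ζ‖ = 1) :
    B ζ ζ + B (Complex.I * ζ) (Complex.I * ζ) = B 1 1 + B Complex.I Complex.I := by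
  have e1 : ζ = ζ.re • (1 : ℂ) + ζ.im • Complex.I := by
    apply Complex.ext <;> simp
  have e2 : Complex.I * ζ = (-ζ.im) • (1 : ℂ) + ζ.re • Complex.I := by
    apply Complex.ext <;> simp
  have e3 : ζ.re ^ 2 + ζ.im ^ 2 = 1 := by
    have := Complex.sq_norm ζ
    rw [hζ, Complex.normSq_apply] at this
    nlinarith
  rw [e2]
  conv_lhs => rw [e1]
  simp only [map_add, map_smul, add_apply, smul_apply,
    smul_eq_mul, Complex.add_re, Complex.add_im, Complex.smul_re, Complex.smul_im, Complex.one_re,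
    Complex.one_im, Complex.I_re, Complex.I_im]
  linear_combination (B 1 1 + B Complex.I Complex.I) * e3

/-- The circle average in terms of second differences: the first-order terms cancel. -/
theorem circleAverage_sub_eq {f : ℂ → ℝ} (hf : Continuous f) (z : ℂ) (r : ℝ) :
    2 * (circleAverage f z r - f z) =
      circleAverage (fun w => f (z + w) + f (z - w) - 2 * f z) 0 r := by
  have hci : ∀ g : ℂ → ℝ, Continuous g → CircleIntegrable g 0 r := fun g hg =>
    hg.continuousOn.circleIntegrable'
  have e1 : circleAverage (fun w => f (z + w)) 0 r = circleAverage f z r := by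
    rw [← circleAverage_map_add_const (f := f) (c := z)]
    simp only [add_comm]
  have e2 : circleAverage (fun w => f (z - w)) 0 r = circleAverage f z r := by
    rw [← circleAverage_neg_radius (f := f), ← circleAverage_map_add_const (f := f) (c := z)]
    unfold circleAverage
    congr 2
    ext θ
    refine congrArg f ?_
    simp only [circleMap]
    push_cast
    ring
  rw [circleAverage_fun_sub (f₁ := fun w => f (z + w) + f (z - w)) (hci _ (by fun_prop))
      (hci _ (by fun_prop)), circleAverage_fun_add (hci _ (by fun_prop)) (hci _ (by fun_prop)), e1, e2, circleAverage_const]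
  ring

theorem circleAverage_comp_I_mul (g : ℂ → ℝ) (r : ℝ) :
    circleAverage (fun w => g (Complex.I * w)) 0 r = circleAverage g 0 r := by
  rw [circleAverage_eq_integral_add (f := g) (π / 2)]
  unfold circleAverage
  congr 2
  ext θ
  refine congrArg g ?_
  simp only [circleMap, zero_add]
  push_cast
  rw [add_mul, Complex.exp_add, Complex.exp_pi_div_two_mul_I]
  ring

theorem exists_abs_circleAverage_sub_le {f : ℂ → ℝ} (hf : ContDiff ℝ 2 f) (R : ℝ) :
    ∃ M : ℝ, 0 ≤ M ∧ ∀ z ∈ closedBall (0 : ℂ) R, ∀ r ∈ Set.Ioc (0 : ℝ) 1,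
      |circleAverage f z r - f z| ≤ M * r ^ 2 := by
  obtain ⟨M, hM0, hM⟩ := exists_abs_second_difference_le hf R
  refine ⟨M, hM0, fun z hz r hr => ?_⟩
  have hfc := hf.continuous
  have h2 : |2 * (circleAverage f z r - f z)| ≤ M * r ^ 2 := by
    rw [circleAverage_sub_eq hfc]
    have hc : Continuous (fun w => f (z + w) + f (z - w) - 2 * f z) := by fun_prop
    refine abs_circleAverage_le_circleAverage_abs.trans ?_
    refine circleAverage_mono_on_of_le_circle hc.abs.continuousOn.circleIntegrable' ?_
    intro w hw
    rw [mem_sphere_zero_iff_norm, abs_of_pos hr.1] at hw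
    simpa [hw] using hM z hz w (hw ▸ hr.2)
  rw [abs_mul, abs_two] at h2
  have := abs_nonneg (circleAverage f z r - f z)
  linarith

/-- The Laplacian is the renormalized limit of circle averages: averaging `D²f(ζ, ζ) + D²f(iζ, iζ)`
over the circle gives the trace of `D²f`. -/
theorem tendsto_circleAverage_sub {f : ℂ → ℝ} (hf : ContDiff ℝ 2 f) (z : ℂ) :
    Tendsto (fun r : ℝ => 4 / r ^ 2 * (circleAverage f z r - f z)) (𝓝[>] 0)
      (𝓝 (Laplacian.laplacian f z)) := by
  have hfc := hf.continuous
  set D : ℂ → ℝ := fun w => f (z + w) + f (z - w) - 2 * f z with hD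
  have hDc : Continuous D := by fun_prop
  obtain ⟨M, hM0, hM⟩ := exists_abs_second_difference_le hf ‖z‖
  have hz : z ∈ closedBall (0 : ℂ) ‖z‖ := by simp
  have key : Tendsto (fun r : ℝ => ∫ θ in (0 : ℝ)..2 * π,
      (D (circleMap 0 r θ) + D (Complex.I * circleMap 0 r θ)) / r ^ 2) (𝓝[>] 0)
      (𝓝 (∫ _θ in (0 : ℝ)..2 * π, Laplacian.laplacian f z)) := by
    refine intervalIntegral.tendsto_integral_filter_of_dominated_convergence (fun _ => 2 * M)
      ?_ ?_ ?_ ?_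
    · refine Eventually.of_forall fun r => ?_
      have : Continuous fun θ => (D (circleMap 0 r θ) + D (Complex.I * circleMap 0 r θ)) / r ^ 2 := by
        fun_prop
      exact this.aestronglyMeasurable
    · filter_upwards [Ioc_mem_nhdsGT (zero_lt_one' ℝ)] with r hr
      refine Eventually.of_forall fun θ _ => ?_
      have hn : ‖circleMap 0 r θ‖ = r := by simp [abs_of_pos hr.1]
      have h1 := hM z hz (circleMap 0 r θ) (by rw [hn]; exact hr.2)
      have h2 := hM z hz (Complex.I * circleMap 0 r θ) (by simpa [hn] using hr.2)
      rw [norm_mul, Complex.norm_I, one_mul] at h2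
      rw [hn] at h1 h2
      rw [Real.norm_eq_abs, abs_div, abs_of_pos (pow_pos hr.1 2), div_le_iff₀ (pow_pos hr.1 2)]
      exact (abs_add_le _ _).trans (by linarith)
    · simp
    · refine Eventually.of_forall fun θ _ => ?_
      have hζ : ‖circleMap 0 1 θ‖ = 1 := by simp
      have h1 := (tendsto_second_difference hf z (circleMap 0 1 θ)).add
        (tendsto_second_difference hf z (Complex.I * circleMap 0 1 θ))
      rw [trace_rotation _ hζ] at h1
      have e : Laplacian.laplacian f z = fderiv ℝ (fderiv ℝ f) z 1 1 +
          fderiv ℝ (fderiv ℝ f) z Complex.I Complex.I := by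
        simp [InnerProductSpace.laplacian_eq_iteratedFDeriv_complexPlane, iteratedFDeriv_two_apply]
      rw [← e] at h1
      refine h1.congr fun r => ?_
      have e2 : circleMap 0 r θ = r • circleMap 0 1 θ := by simp [circleMap]
      rw [e2, ← add_div, mul_smul_comm]
  rw [intervalIntegral.integral_const] at key
  have h3 := key.const_mul ((2 * π)⁻¹)
  have e3 : (2 * π)⁻¹ * ((2 * π - 0) • Laplacian.laplacian f z) = Laplacian.laplacian f z := by
    rw [smul_eq_mul]
    field_simp
    ring
  rw [e3] at h3
  refine h3.congr fun r => ?_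
  have hci : ∀ g : ℂ → ℝ, Continuous g → CircleIntegrable g 0 r := fun g hg =>
    hg.continuousOn.circleIntegrable'
  have e4 : circleAverage (fun w => D w + D (Complex.I * w)) 0 r =
      4 * (circleAverage f z r - f z) := by
    rw [circleAverage_fun_add (hci _ hDc) (hci _ (by fun_prop)), circleAverage_comp_I_mul D,
      ← circleAverage_sub_eq hfc]
    ring
  rw [div_mul_eq_mul_div, ← e4, circleAverage, intervalIntegral.integral_div, smul_eq_mul]
  ring

end LaplacianMean

/-! ### The distributional Laplacian through circle averages -/

section DistributionalLaplacian

open MeasureTheory Filter Real Metric Set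

theorem continuous_circleAverage_center {f : ℂ → ℝ} (hf : Continuous f) (r : ℝ) :
    Continuous fun z => circleAverage f z r := by
  unfold circleAverage circleMap
  fun_prop

theorem circleAverage_eq_zero_of_support_subset {f : ℂ → ℝ} {R : ℝ}
    (hf : ∀ z, R < ‖z‖ → f z = 0) {r : ℝ} (hr : r ∈ Ioc (0 : ℝ) 1) {z : ℂ} (hz : R + 1 < ‖z‖) :
    circleAverage f z r = 0 := by
  refine circleAverage_const_on_circle fun w hw => hf w ?_
  rw [mem_sphere_iff_norm, abs_of_pos hr.1] at hw
  have : ‖z‖ ≤ ‖w‖ + ‖w - z‖ := by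
    rw [← norm_neg (w - z), neg_sub]
    simpa using norm_add_le w (z - w)
  linarith [hr.2]

/-- Circle averaging is symmetric with respect to the pairing `∫ F ψ`. -/
theorem integral_circleAverage_mul {F ψ : ℂ → ℝ} (hFm : Measurable F) (hF : LocallyIntegrable F)
    (hψ : Continuous ψ) (hψc : HasCompactSupport ψ) {r : ℝ} (hr : r ∈ Ioc (0 : ℝ) 1) :
    Integrable (fun z => circleAverage F z r * ψ z) ∧
      ∫ z, circleAverage F z r * ψ z = ∫ z, F z * circleAverage ψ z r := by
  obtain ⟨C, hC⟩ := hψ.bounded_above_of_compact_support hψc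
  obtain ⟨R, hR⟩ := hψc.isCompact.isBounded.subset_closedBall 0
  have hψ0 : ∀ z, R < ‖z‖ → ψ z = 0 := fun z hz => by
    by_contra h
    have := hR (subset_tsupport ψ h)
    rw [mem_closedBall_zero_iff] at this
    linarith
  set ν : Measure ℝ := volume.restrict (Ioc 0 (2 * π)) with hν
  have hK : Integrable ((closedBall (0 : ℂ) (R + 1)).indicator F) :=
    (hF.integrableOn_isCompact (isCompact_closedBall _ _)).integrable_indicator
      measurableSet_closedBall
  have hcm : Measurable fun p : ℂ × ℝ => circleMap 0 r p.2 := by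
    have : Continuous fun p : ℂ × ℝ => circleMap 0 r p.2 := by fun_prop
    exact this.measurable
  have h2 : Integrable (fun p : ℂ × ℝ => F p.1 * ψ (p.1 - circleMap 0 r p.2))
      (volume.prod ν) := by
    refine ((hK.norm).mul_prod (integrable_const (μ := ν) C)).mono ?_ ?_
    · exact ((hFm.comp measurable_fst).mul
        (hψ.measurable.comp (measurable_fst.sub hcm))).aestronglyMeasurable
    · refine Eventually.of_forall fun p => ?_
      have hC0 : 0 ≤ C := (norm_nonneg _).trans (hC 0)
      rw [norm_mul, norm_mul, norm_norm, Real.norm_of_nonneg hC0]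
      by_cases hp : p.1 ∈ closedBall (0 : ℂ) (R + 1)
      · rw [indicator_of_mem hp]
        gcongr
        exact hC _
      · rw [hψ0 (p.1 - circleMap 0 r p.2), norm_zero, mul_zero]
        · positivity
        · rw [mem_closedBall_zero_iff, not_le] at hp
          have := norm_sub_norm_le p.1 (circleMap 0 r p.2)
          rw [norm_circleMap_zero, abs_of_pos hr.1] at this
          linarith [hr.2]
  have hshift : ∀ θ : ℝ, ∫ z, F (z + circleMap 0 r θ) * ψ z =
      ∫ z, F z * ψ (z - circleMap 0 r θ) := fun θ => by
    rw [← integral_add_right_eq_self (fun z => F z * ψ (z - circleMap 0 r θ)) (circleMap 0 r θ)]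
    simp
  have h1 : Integrable (fun p : ℂ × ℝ => F (p.1 + circleMap 0 r p.2) * ψ p.1)
      (volume.prod ν) := by
    have hm : AEStronglyMeasurable (fun p : ℂ × ℝ => F (p.1 + circleMap 0 r p.2) * ψ p.1)
        (volume.prod ν) := ((hFm.comp (measurable_fst.add hcm)).mul
        (hψ.measurable.comp measurable_fst)).aestronglyMeasurable
    rw [integrable_prod_iff' hm]
    constructor
    · filter_upwards [h2.prod_left_ae] with θ hθ
      simpa using hθ.comp_add_right (circleMap 0 r θ)
    · refine h2.norm.integral_prod_right.congr (Eventually.of_forall fun θ => ?_)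
      simp only
      rw [← integral_add_right_eq_self (fun z => ‖F z * ψ (z - circleMap 0 r θ)‖)
        (circleMap 0 r θ)]
      simp
  have e1 : ∀ z, circleAverage F z r * ψ z =
      (2 * π)⁻¹ * ∫ θ, F (z + circleMap 0 r θ) * ψ z ∂ν := fun z => by
    rw [integral_mul_const, circleAverage, smul_eq_mul, mul_assoc,
      intervalIntegral.integral_of_le two_pi_pos.le]
    simp [circleMap, hν]
  have e2 : ∀ z, F z * circleAverage ψ z r =
      (2 * π)⁻¹ * ∫ θ, F z * ψ (z - circleMap 0 r θ) ∂ν := fun z => by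
    rw [integral_const_mul, ← circleAverage_neg_radius, circleAverage, smul_eq_mul, ← mul_assoc,
      mul_comm (F z), mul_assoc, intervalIntegral.integral_of_le two_pi_pos.le]
    simp [circleMap, hν, sub_eq_add_neg]
  constructor
  · simp only [e1]
    exact (h1.integral_prod_left).const_mul _
  · simp only [e1, e2]
    rw [integral_const_mul, integral_const_mul, integral_integral_swap h1]
    simp only [hshift]
    rw [← integral_integral_swap h2]

/-- The distributional Laplacian is the limit of the renormalized circle averages. -/
theorem tendsto_integral_circleAverage_sub {F ψ : ℂ → ℝ} (hFm : Measurable F)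
    (hF : LocallyIntegrable F) (hψ : ContDiff ℝ 2 ψ) (hψc : HasCompactSupport ψ) :
    Tendsto (fun r : ℝ => ∫ z, 4 / r ^ 2 * (circleAverage F z r - F z) * ψ z) (𝓝[>] 0)
      (𝓝 (∫ z, F z * Laplacian.laplacian ψ z)) := by
  obtain ⟨R, hR⟩ := hψc.isCompact.isBounded.subset_closedBall 0
  have hψ0 : ∀ z, R < ‖z‖ → ψ z = 0 := fun z hz => by
    by_contra h
    have := hR (subset_tsupport ψ h)
    rw [mem_closedBall_zero_iff] at this
    linarith
  obtain ⟨M, hM0, hM⟩ := exists_abs_circleAverage_sub_le hψ (R + 1)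
  have hK : Integrable ((closedBall (0 : ℂ) (R + 1)).indicator F) :=
    (hF.integrableOn_isCompact (isCompact_closedBall _ _)).integrable_indicator
      measurableSet_closedBall
  have key : Tendsto (fun r : ℝ => ∫ z, F z * (4 / r ^ 2 * (circleAverage ψ z r - ψ z))) (𝓝[>] 0)
      (𝓝 (∫ z, F z * Laplacian.laplacian ψ z)) := by
    refine tendsto_integral_filter_of_dominated_convergence
      (fun z => ‖(closedBall (0 : ℂ) (R + 1)).indicator F z‖ * (4 * M)) ?_ ?_ ?_ ?_
    · refine Eventually.of_forall fun r => ?_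
      have h1 := (continuous_circleAverage_center hψ.continuous r).measurable
      exact (hFm.mul ((h1.sub hψ.continuous.measurable).const_mul _)).aestronglyMeasurable
    · filter_upwards [Ioc_mem_nhdsGT (zero_lt_one' ℝ)] with r hr
      refine Eventually.of_forall fun z => ?_
      have hr2 : 0 < r ^ 2 := pow_pos hr.1 2
      by_cases hz : z ∈ closedBall (0 : ℂ) (R + 1)
      · rw [indicator_of_mem hz, norm_mul]
        refine mul_le_mul_of_nonneg_left ?_ (norm_nonneg _)
        rw [norm_mul, Real.norm_of_nonneg (by positivity), div_mul_eq_mul_div, div_le_iff₀ hr2,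
          mul_assoc]
        exact mul_le_mul_of_nonneg_left (hM z hz r hr) (by norm_num)
      · have hz' : R + 1 < ‖z‖ := by simpa using hz
        rw [circleAverage_eq_zero_of_support_subset hψ0 hr hz', hψ0 z (by linarith)]
        simp only [sub_zero, mul_zero, norm_zero]
        positivity
    · exact hK.norm.mul_const _
    · exact Eventually.of_forall fun z => (tendsto_circleAverage_sub hψ z).const_mul _
  refine key.congr' ?_
  filter_upwards [Ioc_mem_nhdsGT (zero_lt_one' ℝ)] with r hr
  obtain ⟨hi, he⟩ := integral_circleAverage_mul hFm hF hψ.continuous hψc hr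
  have hFψ : Integrable (fun z => F z * ψ z) := by
    simpa [mul_comm, smul_eq_mul] using
      hF.integrable_smul_left_of_hasCompactSupport hψ.continuous hψc
  have hFA : Integrable (fun z => F z * circleAverage ψ z r) := by
    have hsupp : HasCompactSupport fun z => circleAverage ψ z r := by
      refine HasCompactSupport.intro (isCompact_closedBall 0 (R + 1)) fun z hz => ?_
      exact circleAverage_eq_zero_of_support_subset hψ0 hr (by simpa using hz)
    simpa [mul_comm, smul_eq_mul] using hF.integrable_smul_left_of_hasCompactSupport
      (continuous_circleAverage_center hψ.continuous r) hsupp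
  have e1 : ∀ z, F z * (4 / r ^ 2 * (circleAverage ψ z r - ψ z)) =
      4 / r ^ 2 * (F z * circleAverage ψ z r - F z * ψ z) := fun z => by ring
  have e2 : ∀ z, 4 / r ^ 2 * (circleAverage F z r - F z) * ψ z =
      4 / r ^ 2 * (circleAverage F z r * ψ z - F z * ψ z) := fun z => by ring
  simp only [e1, e2]
  rw [integral_const_mul, integral_const_mul, integral_sub hFA hFψ, integral_sub hi hFψ, he]

theorem integral_laplacian_eq_zero {ψ : ℂ → ℝ} (hψ : ContDiff ℝ 2 ψ) (hψc : HasCompactSupport ψ) :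
    ∫ z, Laplacian.laplacian ψ z = 0 := by
  have h := tendsto_integral_circleAverage_sub (F := fun _ => 1) measurable_const
    (continuous_const.locallyIntegrable) hψ hψc
  simp only [circleAverage_const, sub_self, mul_zero, zero_mul, integral_zero, one_mul] at h
  exact tendsto_nhds_unique h tendsto_const_nhds

theorem integrableOn_log_norm_ball (ρ : ℝ) :
    IntegrableOn (fun z : ℂ => log ‖z‖) (ball 0 ρ) := by
  rw [integrableOn_fun_norm_addHaar volume (f := log)]
  have : Continuous fun y : ℝ => y * log y := Real.continuous_mul_log
  simpa using this.integrableOn_Icc.mono_set Ioo_subset_Icc_self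

theorem locallyIntegrable_log_norm_sub (a : ℂ) :
    LocallyIntegrable fun z : ℂ => log ‖z - a‖ := by
  intro z
  refine ⟨ball a (‖z - a‖ + 1), isOpen_ball.mem_nhds (by simp [dist_eq_norm]), ?_⟩
  have h := (integrableOn_log_norm_ball (‖z - a‖ + 1))
  rw [← integrable_indicator_iff measurableSet_ball] at h ⊢
  refine (h.comp_sub_right a).congr (Eventually.of_forall fun w => ?_)
  simp [indicator, dist_eq_norm]

theorem integral_ball_log_norm : ∫ z in ball (0 : ℂ) 1, log ‖z‖ = -(π / 2) := by
  have e : ∀ z : ℂ, (ball (0 : ℂ) 1).indicator (fun z => log ‖z‖) z =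
      (fun y : ℝ => (Iio (1 : ℝ)).indicator log y) ‖z‖ := fun z => by
    simp [indicator]
  rw [← integral_indicator measurableSet_ball]
  simp only [e]
  rw [integral_fun_norm_addHaar volume (fun y : ℝ => (Iio (1 : ℝ)).indicator log y)]
  have e2 : ∀ y : ℝ, y ^ (Module.finrank ℝ ℂ - 1) • (Iio (1 : ℝ)).indicator log y =
      (Iio (1 : ℝ)).indicator (fun y => y * log y) y := fun y => by
    by_cases hy : y < 1 <;> simp [hy]
  simp only [e2]
  rw [setIntegral_indicator measurableSet_Iio, Ioi_inter_Iio, ← integral_Ioc_eq_integral_Ioo,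
    ← intervalIntegral.integral_of_le zero_le_one]
  have hder : ∀ x ∈ Ioo (0 : ℝ) 1,
      HasDerivAt (fun x => x * (x * log x) / 2 - x ^ 2 / 4) (x * log x) x := fun x hx => by
    have h1 := Real.hasDerivAt_mul_log hx.1.ne'
    refine ((((hasDerivAt_id x).mul h1).div_const 2).sub
      ((hasDerivAt_pow 2 x).div_const 4)).congr_deriv ?_
    simp
    ring
  have hcont : Continuous fun x : ℝ => x * (x * log x) / 2 - x ^ 2 / 4 := by
    have := Real.continuous_mul_log
    fun_prop
  rw [intervalIntegral.integral_eq_sub_of_hasDerivAt_of_le zero_le_one hcont.continuousOn hder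
    (Real.continuous_mul_log.intervalIntegrable _ _)]
  have hvol : (volume : Measure ℂ).real (ball 0 1) = π := by
    simp [Measure.real]
  rw [hvol]
  simp
  ring

/-- Averaging `log |· - a|` over a circle changes its value only if the circle encloses `a`. -/
theorem circleAverage_log_sub_log {a z : ℂ} (hz : z ≠ a) {r : ℝ} (hr : 0 < r) :
    circleAverage (fun w => log ‖w - a‖) z r - log ‖z - a‖ =
      (ball a r).indicator (fun w => -log (r⁻¹ * ‖w - a‖)) z := by
  have hz' : 0 < ‖z - a‖ := norm_pos_iff.2 (sub_ne_zero.2 hz)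
  rw [circleAverage_log_norm_sub_const_eq_log_radius_add_posLog hr.ne']
  by_cases h : z ∈ ball a r
  · rw [indicator_of_mem h]
    rw [mem_ball_iff_norm] at h
    rw [posLog_eq_zero_iff _ |>.2, log_mul (inv_ne_zero hr.ne') hz'.ne', log_inv]
    · ring
    · rw [abs_of_pos (by positivity), inv_mul_le_iff₀ hr]
      linarith
  · rw [indicator_of_notMem h]
    rw [mem_ball_iff_norm, not_lt] at h
    rw [posLog_eq_log, log_mul (inv_ne_zero hr.ne') hz'.ne', log_inv]
    · ring
    · rw [abs_of_pos (by positivity), le_inv_mul_iff₀ hr]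
      linarith

theorem log_le_circleAverage_log {a z : ℂ} (hz : z ≠ a) {r : ℝ} (hr : 0 < r) :
    log ‖z - a‖ ≤ circleAverage (fun w => log ‖w - a‖) z r := by
  rw [← sub_nonneg, circleAverage_log_sub_log hz hr]
  refine indicator_nonneg (fun w hw => ?_) z
  rw [mem_ball_iff_norm] at hw
  rw [neg_nonneg]
  refine log_nonpos (by positivity) ?_
  rw [inv_mul_le_iff₀ hr]
  linarith

/-- The logarithm is the fundamental solution of the Laplacian: `Δ log |z - a| = 2π δ_a`. -/
theorem integral_log_norm_sub_mul_laplacian {ψ : ℂ → ℝ} (hψ : ContDiff ℝ 2 ψ)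
    (hψc : HasCompactSupport ψ) (a : ℂ) :
    ∫ z, log ‖z - a‖ * Laplacian.laplacian ψ z = 2 * π * ψ a := by
  have hm : Measurable fun z : ℂ => log ‖z - a‖ := by fun_prop
  have h := tendsto_integral_circleAverage_sub hm (locallyIntegrable_log_norm_sub a) hψ hψc
  refine tendsto_nhds_unique h ?_
  -- rescaling the disc of radius `r` about `a` to the unit disc
  have key : Tendsto (fun r : ℝ => ∫ w in ball (0 : ℂ) 1, 4 * -log ‖w‖ * ψ (a + r • w)) (𝓝[>] 0)
      (𝓝 (∫ w in ball (0 : ℂ) 1, 4 * -log ‖w‖ * ψ a)) := by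
    obtain ⟨C, hC⟩ := hψ.continuous.bounded_above_of_compact_support hψc
    have hψm := hψ.continuous.measurable
    refine tendsto_integral_filter_of_dominated_convergence (fun w => ‖4 * -log ‖w‖‖ * C)
      ?_ ?_ ?_ ?_
    · refine Eventually.of_forall fun r => Measurable.aestronglyMeasurable ?_
      fun_prop
    · refine Eventually.of_forall fun r => Eventually.of_forall fun w => ?_
      rw [norm_mul]
      exact mul_le_mul_of_nonneg_left (hC _) (norm_nonneg _)
    · exact ((integrableOn_log_norm_ball 1).neg.const_mul 4).norm.mul_const C
    · refine Eventually.of_forall fun w => Tendsto.const_mul _ ?_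
      have hc : Continuous fun r : ℝ => ψ (a + r • w) := by
        have := hψ.continuous
        fun_prop
      simpa using (hc.tendsto 0).mono_left nhdsWithin_le_nhds
  have e : ∫ w in ball (0 : ℂ) 1, 4 * -log ‖w‖ * ψ a = 2 * π * ψ a := by
    rw [integral_mul_const, integral_const_mul, integral_neg, integral_ball_log_norm]
    ring
  rw [e] at key
  refine key.congr' ?_
  filter_upwards [self_mem_nhdsWithin] with r hr
  have hr : 0 < r := hr
  set G : ℂ → ℝ := (ball (0 : ℂ) 1).indicator fun w => 4 * -log ‖w‖ * ψ (a + r • w) with hG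
  have e1 : ∫ w in ball (0 : ℂ) 1, 4 * -log ‖w‖ * ψ (a + r • w) =
      r⁻¹ ^ 2 * ∫ z, G (r⁻¹ • (z - a)) := by
    rw [integral_sub_right_eq_self (fun z => G (r⁻¹ • z)) a,
      Measure.integral_comp_smul_of_nonneg volume G _ (hR := (by positivity)),
      ← integral_indicator measurableSet_ball]
    simp only [Complex.finrank_real_complex, smul_eq_mul, ← mul_assoc]
    rw [mul_inv_cancel₀ (by positivity), one_mul]
  rw [e1, ← integral_const_mul]
  refine integral_congr_ae ?_
  filter_upwards [compl_mem_ae_iff.2 (measure_singleton (μ := (volume : Measure ℂ)) a)] with z hz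
  rw [circleAverage_log_sub_log hz hr]
  have hmem : r⁻¹ • (z - a) ∈ ball (0 : ℂ) 1 ↔ z ∈ ball a r := by
    rw [mem_ball_zero_iff, mem_ball_iff_norm, norm_smul, Real.norm_of_nonneg (by positivity),
      inv_mul_lt_iff₀ hr, mul_one]
  by_cases hz' : z ∈ ball a r
  · rw [hG, indicator_of_mem (hmem.2 hz'), indicator_of_mem hz', smul_inv_smul₀ hr.ne',
      norm_smul, Real.norm_of_nonneg (by positivity)]
    simp only [add_sub_cancel]
    field_simp
  · rw [hG, indicator_of_notMem (fun h => hz' (hmem.1 h)), indicator_of_notMem hz']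
    simp

theorem circleAverage_norm_eq (F : ℂ → ℝ) (c w : ℂ) :
    circleAverage F c ‖w‖ =
      (2 * π)⁻¹ * ∫ θ in Ioc 0 (2 * π), F (c + circleMap 0 1 θ * w) := by
  rw [circleAverage_eq_integral_add (Complex.arg w), smul_eq_mul,
    intervalIntegral.integral_of_le two_pi_pos.le]
  congr 2
  ext θ
  refine congrArg F ?_
  conv_rhs => rw [← Complex.norm_mul_exp_arg_mul_I w]
  simp only [circleMap, zero_add]
  push_cast
  rw [add_mul, Complex.exp_add]
  ring

/-- A function satisfying the sub-mean value inequality on circles satisfies it on discs. -/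
theorem mul_le_setIntegral_ball {F : ℂ → ℝ} (hFm : Measurable F) {c : ℂ} {ρ : ℝ}
    (hF : IntegrableOn F (ball c ρ)) (hmean : ∀ r, 0 < r → F c ≤ circleAverage F c r) :
    volume.real (ball c ρ) * F c ≤ ∫ z in ball c ρ, F z := by
  set G : ℂ → ℝ := (ball (0 : ℂ) ρ).indicator fun w => F (c + w) with hG
  have hGe : ∀ w, G w = (ball c ρ).indicator F (c + w) := fun w => by
    simp [hG, indicator]
  have hGm : Measurable G := (hFm.comp (measurable_const_add c)).indicator measurableSet_ball
  have hGi : Integrable G := by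
    rw [← integrable_indicator_iff measurableSet_ball] at hF
    exact (hF.comp_add_left c).congr (Eventually.of_forall fun w => (hGe w).symm)
  have hGint : ∫ z in ball c ρ, F z = ∫ w, G w := by
    simp only [hGe]
    rw [integral_add_left_eq_self (fun w => (ball c ρ).indicator F w) c,
      integral_indicator measurableSet_ball]
  have hrot : ∀ θ : ℝ, MeasurePreserving (fun w : ℂ => circleMap 0 1 θ * w) := fun θ => by
    have h := (rotation (Circle.exp θ)).measurePreserving
    convert h using 2 with w
    simp [circleMap, rotation_apply]
  have hemb : ∀ θ : ℝ, MeasurableEmbedding (fun w : ℂ => circleMap 0 1 θ * w) := fun θ => by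
    have h := (rotation (Circle.exp θ)).toHomeomorph.measurableEmbedding
    convert h using 2 with w
    simp [circleMap, rotation_apply]
  set ν : Measure ℝ := volume.restrict (Ioc 0 (2 * π)) with hν
  have hint : Integrable (fun p : ℂ × ℝ => G (circleMap 0 1 p.2 * p.1)) (volume.prod ν) := by
    have hcm : Measurable fun p : ℂ × ℝ => circleMap 0 1 p.2 * p.1 := by
      have : Continuous fun p : ℂ × ℝ => circleMap 0 1 p.2 * p.1 := by fun_prop
      exact this.measurable
    have hGc : Measurable fun p : ℂ × ℝ => G (circleMap 0 1 p.2 * p.1) := hGm.comp hcm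
    rw [integrable_prod_iff' hGc.aestronglyMeasurable]
    refine ⟨Eventually.of_forall fun θ => (hrot θ).integrable_comp_of_integrable hGi, ?_⟩
    have : ∀ θ, ∫ w, ‖G (circleMap 0 1 θ * w)‖ = ∫ w, ‖G w‖ := fun θ =>
      (hrot θ).integral_comp (hemb θ) fun w => ‖G w‖
    simp only [this]
    exact integrable_const _
  have havg : ∀ w, (ball (0 : ℂ) ρ).indicator (fun w => circleAverage F c ‖w‖) w =
      (2 * π)⁻¹ * ∫ θ, G (circleMap 0 1 θ * w) ∂ν := fun w => by
    by_cases hw : w ∈ ball (0 : ℂ) ρ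
    · have : ∀ θ : ℝ, circleMap 0 1 θ * w ∈ ball (0 : ℂ) ρ := fun θ => by
        simpa using hw
      simp only [hG, indicator_of_mem hw, indicator_of_mem (this _), circleAverage_norm_eq, hν]
    · have : ∀ θ : ℝ, circleMap 0 1 θ * w ∉ ball (0 : ℂ) ρ := fun θ => by
        simpa using hw
      simp only [hG, indicator_of_notMem hw, indicator_of_notMem (this _), integral_zero, mul_zero]
  have hint1 : Integrable ((ball (0 : ℂ) ρ).indicator (fun w => circleAverage F c ‖w‖)) := by
    simp only [funext havg]
    exact hint.integral_prod_left.const_mul _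
  have hfub : ∫ w, (ball (0 : ℂ) ρ).indicator (fun w => circleAverage F c ‖w‖) w = ∫ w, G w := by
    simp only [havg]
    rw [integral_const_mul, integral_integral_swap hint]
    have : ∀ θ, ∫ w, G (circleMap 0 1 θ * w) = ∫ w, G w := fun θ =>
      (hrot θ).integral_comp (hemb θ) G
    simp only [this, hν, integral_const, smul_eq_mul]
    rw [measureReal_restrict_apply_univ, Real.volume_real_Ioc_of_le two_pi_pos.le]
    field_simp
    ring
  rw [hGint, ← hfub]
  have hvol : volume.real (ball c ρ) * F c = ∫ w, (ball (0 : ℂ) ρ).indicator (fun _ => F c) w := by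
    rw [integral_indicator measurableSet_ball, setIntegral_const, smul_eq_mul]
    congr 1
    simp [Measure.real]
  rw [hvol]
  refine integral_mono ?_ hint1 fun w => ?_
  · rw [integrable_indicator_iff measurableSet_ball]
    exact integrableOn_const (measure_ball_lt_top).ne
  · by_cases hw : w ∈ ball (0 : ℂ) ρ
    · simp only [indicator_of_mem hw]
      rcases eq_or_ne w 0 with rfl | hw0
      · simp
      · exact hmean _ (norm_pos_iff.2 hw0)
    · simp only [indicator_of_notMem hw, le_refl]

end DistributionalLaplacian

/-! ### The maximum principle and the equilibrium potential -/

section EquilibriumPotential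

open MeasureTheory Filter Real Metric Set RandomPoly

/-- The sub-mean value property of a real-valued function, tested against continuous majorants on
circles. -/
def HasSubMean (w : ℂ → ℝ) : Prop :=
  ∀ (c : ℂ) (r : ℝ), 0 < r → ∀ g : ℂ → ℝ, Continuous g → (∀ z ∈ sphere c r, w z ≤ g z) →
    w c ≤ circleAverage g c r

theorem continuous_circleIntegrable {g : ℂ → ℝ} (hg : Continuous g) (c : ℂ) (r : ℝ) :
    CircleIntegrable g c r :=
  hg.continuousOn.circleIntegrable'

theorem circleAverage_fun_mul_left (a : ℝ) (f : ℂ → ℝ) (c : ℂ) (r : ℝ) :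
    circleAverage (fun z => a * f z) c r = a * circleAverage f c r := by
  simpa only [smul_eq_mul] using circleAverage_fun_smul (a := a) (f := f) (c := c) (R := r)

/-- Monotonicity of circle averages, where one point of the circle may be disregarded. -/
theorem circleAverage_mono_of_ne {f g : ℂ → ℝ} {c : ℂ} {r : ℝ} (hr : r ≠ 0)
    (hf : CircleIntegrable f c r) (hg : CircleIntegrable g c r) (a : ℂ)
    (h : ∀ z, z ≠ a → f z ≤ g z) : circleAverage f c r ≤ circleAverage g c r := by
  classical
  have he : f =ᶠ[codiscreteWithin (sphere c |r|)] Function.update f a (g a) := by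
    filter_upwards [compl_singleton_mem_codiscreteWithin (s := sphere c |r|) a] with z hz
    rw [Function.update_of_ne hz]
  rw [circleAverage_congr_codiscreteWithin he hr]
  refine circleAverage_mono (CircleIntegrable.congr_codiscreteWithin he hf) hg fun z _ => ?_
  rcases eq_or_ne z a with rfl | hz
  · simp
  · rw [Function.update_of_ne hz]
    exact h z hz

theorem circleAverage_norm_sq (c : ℂ) (r : ℝ) :
    circleAverage (fun z => ‖z‖ ^ 2) c r = ‖c‖ ^ 2 + r ^ 2 := by
  have h := circleAverage_sub_eq (f := fun z => ‖z‖ ^ 2) (by fun_prop) c r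
  have h2 : circleAverage (fun w => ‖c + w‖ ^ 2 + ‖c - w‖ ^ 2 - 2 * ‖c‖ ^ 2) 0 r = 2 * r ^ 2 := by
    refine circleAverage_const_on_circle fun w hw => ?_
    rw [mem_sphere_zero_iff_norm] at hw
    have := parallelogram_law_with_norm ℝ c w
    have h3 : ‖w‖ ^ 2 = r ^ 2 := by rw [hw, sq_abs]
    nlinarith
  rw [h2] at h
  linarith

/-- The maximum principle: at every point of the compact set `K` either `w ≤ h` is known, or `h` has
the super-mean value property on a small circle in `K`. -/
theorem HasSubMean.le_of_compact {w h : ℂ → ℝ} (hw : HasSubMean w) (hus : UpperSemicontinuous w)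
    (hh : Continuous h) {K : Set ℂ} (hK : IsCompact K)
    (hloc : ∀ z ∈ K, w z ≤ h z ∨ ∃ r, 0 < r ∧ sphere z r ⊆ K ∧ circleAverage h z r ≤ h z) :
    ∀ z ∈ K, w z ≤ h z := by
  intro z hz
  obtain ⟨R, hR⟩ := hK.isBounded.subset_closedBall 0
  -- a strictly subharmonic perturbation forces the maximum to the points where `w ≤ h`
  have key : ∀ κ : ℝ, 0 < κ → w z ≤ h z + κ * R ^ 2 := by
    intro κ hκ
    have hus' : UpperSemicontinuousOn (fun z => w z + (κ * ‖z‖ ^ 2 - h z)) K :=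
      (hus.add (Continuous.upperSemicontinuous (by fun_prop))).upperSemicontinuousOn K
    obtain ⟨c, hcK, hc⟩ := hus'.exists_isMaxOn ⟨z, hz⟩ hK
    have hmax : ∀ y ∈ K, w y + (κ * ‖y‖ ^ 2 - h y) ≤ w c + (κ * ‖c‖ ^ 2 - h c) := fun y hy => hc hy
    rcases hloc c hcK with hle | ⟨r, hr, hsub, havg⟩
    · have h1 := hmax z hz
      have h2 : ‖c‖ ≤ R := by simpa using hR hcK
      have h3 : ‖c‖ ^ 2 ≤ R ^ 2 := by gcongr
      nlinarith [sq_nonneg ‖z‖]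
    · exfalso
      have hg : Continuous fun y : ℂ => h y - κ * ‖y‖ ^ 2 := by fun_prop
      have h1 := hw c r hr (fun y => h y - κ * ‖y‖ ^ 2 + (w c + (κ * ‖c‖ ^ 2 - h c)))
        (by fun_prop) fun y hy => by linarith [hmax y (hsub hy)]
      rw [circleAverage_fun_add (continuous_circleIntegrable hg c r)
          (continuous_circleIntegrable continuous_const c r),
        circleAverage_fun_sub (continuous_circleIntegrable hh c r)
          (continuous_circleIntegrable (by fun_prop) c r), circleAverage_const] at h1
      have h2 : circleAverage (fun y : ℂ => κ * ‖y‖ ^ 2) c r = κ * (‖c‖ ^ 2 + r ^ 2) := by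
        rw [← circleAverage_norm_sq]
        exact circleAverage_fun_mul_left _ _ _ _
      rw [h2] at h1
      have : 0 < κ * r ^ 2 := by positivity
      nlinarith
  have hlim : Tendsto (fun κ : ℝ => h z + κ * R ^ 2) (𝓝[>] 0) (𝓝 (h z + 0 * R ^ 2)) :=
    (Continuous.tendsto (by fun_prop) 0).mono_left nhdsWithin_le_nhds
  rw [zero_mul, add_zero] at hlim
  exact ge_of_tendsto hlim (eventually_mem_nhdsWithin.mono fun κ hκ => key κ hκ)

theorem HasSubMean.le_of_norm_le {w : ℂ → ℝ} (hw : HasSubMean w) (hus : UpperSemicontinuous w)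
    {r b : ℝ} (hb : ∀ z, ‖z‖ = r → w z ≤ b) {z : ℂ} (hz : ‖z‖ ≤ r) : w z ≤ b := by
  refine hw.le_of_compact hus (h := fun _ => b) continuous_const (isCompact_closedBall (0 : ℂ) r)
    (fun y hy => ?_) z (by simpa using hz)
  rw [mem_closedBall_zero_iff] at hy
  rcases hy.eq_or_lt with hy | hy
  · exact Or.inl (hb y hy)
  · refine Or.inr ⟨r - ‖y‖, by linarith, fun x hx => ?_, (circleAverage_const _ _ _).le⟩
    rw [mem_sphere_iff_norm] at hx
    rw [mem_closedBall_zero_iff]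
    have := norm_sub_norm_le x y
    linarith

/-- The two-constants form of the three circles theorem. -/
theorem HasSubMean.le_of_annulus {w : ℂ → ℝ} (hw : HasSubMean w) (hus : UpperSemicontinuous w)
    {r₁ r₂ a b : ℝ} (hr₁ : 0 < r₁) (h1 : ∀ z, ‖z‖ = r₁ → w z ≤ a * log r₁ + b)
    (h2 : ∀ z, ‖z‖ = r₂ → w z ≤ a * log r₂ + b) {z : ℂ} (hz1 : r₁ ≤ ‖z‖) (hz2 : ‖z‖ ≤ r₂) :
    w z ≤ a * log ‖z‖ + b := by
  have hpos : ∀ y : ℂ, 0 < max ‖y‖ r₁ := fun y => lt_max_of_lt_right hr₁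
  have hcont : Continuous fun y : ℂ => a * log (max ‖y‖ r₁) + b := by
    refine (continuous_const.mul (Continuous.log (by fun_prop) fun y => (hpos y).ne')).add
      continuous_const
  have hKc : IsCompact (closedBall (0 : ℂ) r₂ ∩ {y | r₁ ≤ ‖y‖}) :=
    (isCompact_closedBall (0 : ℂ) r₂).inter_right (isClosed_le continuous_const continuous_norm)
  have := hw.le_of_compact hus hcont hKc (fun y hy => ?_) z ⟨by simpa using hz2, hz1⟩
  · simpa [max_eq_left hz1] using this
  obtain ⟨hy2, hy1⟩ := hy
  rw [mem_closedBall_zero_iff] at hy2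
  have hy1 : r₁ ≤ ‖y‖ := hy1
  rcases hy2.eq_or_lt with hy2 | hy2
  · left
    rw [max_eq_left hy1, hy2]
    exact h2 y hy2
  rcases hy1.eq_or_lt with hy1 | hy1
  · left
    simpa [hy1] using h1 y hy1.symm
  right
  have hsph : ∀ x ∈ sphere y (min (r₂ - ‖y‖) (‖y‖ - r₁)), r₁ ≤ ‖x‖ ∧ ‖x‖ ≤ r₂ := fun x hx => by
    rw [mem_sphere_iff_norm] at hx
    have := norm_sub_norm_le x y
    have h3 := norm_sub_norm_le y x
    rw [norm_sub_rev] at h3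
    have := min_le_left (r₂ - ‖y‖) (‖y‖ - r₁)
    have := min_le_right (r₂ - ‖y‖) (‖y‖ - r₁)
    constructor <;> linarith
  have hρ : 0 < min (r₂ - ‖y‖) (‖y‖ - r₁) := lt_min (by linarith) (by linarith)
  refine ⟨min (r₂ - ‖y‖) (‖y‖ - r₁), hρ,
    fun x hx => ⟨by simpa using (hsph x hx).2, (hsph x hx).1⟩, le_of_eq ?_⟩
  set ρ := min (r₂ - ‖y‖) (‖y‖ - r₁) with hρdef
  have e1 : circleAverage (fun y : ℂ => a * log (max ‖y‖ r₁) + b) y ρ =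
      circleAverage (fun x : ℂ => a * log ‖x - 0‖ + b) y ρ := by
    refine circleAverage_congr_sphere fun x hx => ?_
    rw [abs_of_pos hρ] at hx
    simp [max_eq_left (hsph x hx).1]
  have hci : CircleIntegrable (fun x : ℂ => log ‖x - 0‖) y ρ := circleIntegrable_log_norm_sub_const _
  have e2 : circleAverage (fun x : ℂ => a * log ‖x - 0‖) y ρ = a * log ‖y‖ := by
    have h3 : circleAverage (fun x : ℂ => a * log ‖x - 0‖) y ρ =
      a * circleAverage (fun x : ℂ => log ‖x - 0‖) y ρ :=
        circleAverage_fun_mul_left _ _ _ _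
    have hy0 : y ≠ 0 := norm_pos_iff.1 (hr₁.trans hy1)
    have h4 := circleAverage_log_sub_log hy0 hρ
    rw [indicator_of_notMem, sub_zero] at h4
    · rw [h3, sub_eq_zero.1 h4]
    · rw [mem_ball_zero_iff, not_lt]
      linarith [min_le_right (r₂ - ‖y‖) (‖y‖ - r₁)]
  have hci2 : CircleIntegrable (fun x : ℂ => a * log ‖x - 0‖) y ρ := hci.const_fun_smul (a := a)
  rw [e1, circleAverage_fun_add hci2 (continuous_circleIntegrable continuous_const y ρ), e2,
    circleAverage_const, max_eq_left hy1.le]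

/-- Truncating a competitor for the equilibrium potential at height `0` makes it real-valued. -/
theorem exists_real_competitor {φ : ℂ → ℝ} (hφ0 : ∀ z, 0 ≤ φ z) {u : ℂ → EReal}
    (hu : u ∈ LelongClass) (huφ : ∀ w, u w ≤ (φ w : EReal)) :
    ∃ w : ℂ → ℝ, UpperSemicontinuous w ∧ HasSubMean w ∧ (∀ z, w z ≤ φ z) ∧
      (∃ C : ℝ, ∀ᶠ z in Bornology.cobounded ℂ, w z ≤ log ‖z‖ + C) ∧
      ∀ z (x : ℝ), u z = x → x ≤ w z := by
  obtain ⟨⟨husc, -, hmean⟩, C, hC⟩ := hu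
  have hcoe : ∀ z, ((max (u z) 0).toReal : EReal) = max (u z) 0 := fun z => by
    refine EReal.coe_toReal ?_ ?_
    · exact (max_lt (lt_of_le_of_lt (huφ z) (EReal.coe_lt_top _)) EReal.zero_lt_top).ne
    · exact (lt_of_lt_of_le EReal.bot_lt_zero (le_max_right _ _)).ne'
  have hle : ∀ z (y : ℝ), (max (u z) 0).toReal ≤ y ↔ u z ≤ y ∧ 0 ≤ y := fun z y => by
    rw [← EReal.coe_le_coe_iff, hcoe, max_le_iff, ← EReal.coe_zero, EReal.coe_le_coe_iff]
  have hlt : ∀ z (y : ℝ), (max (u z) 0).toReal < y ↔ u z < y ∧ 0 < y := fun z y => by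
    rw [← EReal.coe_lt_coe_iff, hcoe, max_lt_iff, ← EReal.coe_zero, EReal.coe_lt_coe_iff]
  refine ⟨fun z => (max (u z) 0).toReal, ?_, ?_, ?_, ?_, ?_⟩
  · intro z y hy
    obtain ⟨h1, h2⟩ := (hlt z y).1 hy
    filter_upwards [husc z _ h1] with x hx
    exact (hlt x y).2 ⟨hx, h2⟩
  · intro c r hr g hg hgs
    refine (hle _ _).2 ⟨hmean c r hr g hg fun z hz => ((hle _ _).1 (hgs z hz)).1, ?_⟩
    refine circleAverage_nonneg_of_nonneg fun z hz => ?_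
    rw [abs_of_pos hr] at hz
    exact ((hle _ _).1 (hgs z hz)).2
  · exact fun z => (hle _ _).2 ⟨huφ z, hφ0 z⟩
  · refine ⟨max C 0, ?_⟩
    filter_upwards [hC, tendsto_norm_cobounded_atTop.eventually_ge_atTop 1] with z hz hz1
    have h1 := log_nonneg hz1
    refine (hle _ _).2 ⟨hz.trans ?_, by positivity⟩
    rw [EReal.coe_le_coe_iff]
    gcongr
    exact le_max_left _ _
  · intro z x hx
    rw [← EReal.coe_le_coe_iff, hcoe, ← hx]
    exact le_max_left _ _

/-- Continuous real-valued competitors lie below the equilibrium potential. -/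
theorem le_equilibriumPotential {φ u : ℂ → ℝ} (hu : Continuous u)
    (hmean : ∀ c r, 0 < r → u c ≤ circleAverage u c r) (hle : ∀ z, u z ≤ φ z)
    (hC : ∃ C : ℝ, ∀ᶠ z in Bornology.cobounded ℂ, u z ≤ log ‖z‖ + C) (z : ℂ) :
    u z ≤ equilibriumPotential φ z := by
  obtain ⟨C, hC⟩ := hC
  refine le_csSup ⟨φ z, ?_⟩ ⟨fun z => (u z : EReal), ⟨⟨?_, ?_, ?_⟩, C, ?_⟩, ?_, rfl⟩
  · rintro x ⟨v, -, hv, hx⟩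
    rw [← EReal.coe_le_coe_iff, ← hx]
    exact hv z
  · exact (continuous_coe_real_ereal.comp hu).upperSemicontinuous
  · exact fun z => EReal.coe_ne_top _
  · intro c r hr g hg hgs
    rw [EReal.coe_le_coe_iff]
    refine (hmean c r hr).trans (circleAverage_mono (continuous_circleIntegrable hu c r)
      (continuous_circleIntegrable hg c r) fun z hz => ?_)
    rw [abs_of_pos hr] at hz
    exact EReal.coe_le_coe_iff.1 (hgs z hz)
  · filter_upwards [hC] with z hz
    exact EReal.coe_le_coe_iff.2 hz
  · exact fun z => EReal.coe_le_coe_iff.2 (hle z)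

theorem const_le_equilibriumPotential {φ : ℂ → ℝ} {b : ℝ} (hb : ∀ z, b ≤ φ z) (z : ℂ) :
    b ≤ equilibriumPotential φ z := by
  refine le_equilibriumPotential (u := fun _ => b) continuous_const
    (fun c r _ => (circleAverage_const _ _ _).ge) hb ⟨b, ?_⟩ z
  filter_upwards [tendsto_norm_cobounded_atTop.eventually_ge_atTop 1] with z hz1
  linarith [log_nonneg hz1]

theorem equilibriumPotential_nonneg {φ : ℂ → ℝ} (hφ0 : ∀ z, 0 ≤ φ z) (z : ℂ) :
    0 ≤ equilibriumPotential φ z :=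
  const_le_equilibriumPotential hφ0 z

theorem log_le_equilibriumPotential {φ : ℂ → ℝ} (hφc : Continuous φ) (hφ0 : ∀ z, 0 ≤ φ z)
    {s b : ℝ} (hs0 : 0 ≤ s) (hs1 : s ≤ 1) (h : ∀ z, z ≠ 0 → s * log ‖z‖ + b ≤ φ z) {z : ℂ}
    (hz : z ≠ 0) : s * log ‖z‖ + b ≤ equilibriumPotential φ z := by
  rcases hs0.eq_or_lt with rfl | hs
  · rw [zero_mul, zero_add]
    refine const_le_equilibriumPotential (fun w => ?_) z
    have hcl : closure ({0}ᶜ : Set ℂ) ⊆ {w | b ≤ φ w} :=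
      closure_minimal (fun w hw => by simpa using h w hw) (isClosed_le continuous_const hφc)
    exact hcl (by rw [closure_compl_singleton]; trivial)
  -- the competitor is `max (s log |w| + b) 0 = s log (max |w| ρ) + b`
  set ρ := exp (-b / s) with hρ
  have hρ0 : 0 < ρ := exp_pos _
  have hρb : s * log ρ + b = 0 := by
    rw [hρ, log_exp]
    field_simp
    ring
  have hpos : ∀ y : ℂ, 0 < max ‖y‖ ρ := fun y => lt_max_of_lt_right hρ0
  have hcont : Continuous fun y : ℂ => s * log (max ‖y‖ ρ) + b := by
    refine (continuous_const.mul (Continuous.log (by fun_prop) fun y => (hpos y).ne')).add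
      continuous_const
  have hge : ∀ y : ℂ, 0 ≤ s * log (max ‖y‖ ρ) + b := fun y => by
    rw [← hρb]
    gcongr
    exact le_max_right _ _
  have hge2 : ∀ y : ℂ, y ≠ 0 → s * log ‖y‖ + b ≤ s * log (max ‖y‖ ρ) + b := fun y hy => by
    have := norm_pos_iff.2 hy
    gcongr
    exact le_max_left _ _
  refine (hge2 z hz).trans (le_equilibriumPotential hcont (fun c r hr => ?_) (fun w => ?_)
    ⟨|b|, ?_⟩ z)
  · rcases le_total ‖c‖ ρ with hc | hc
    · rw [max_eq_right hc, hρb]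
      exact circleAverage_nonneg_of_nonneg fun z _ => hge z
    · have hc0 : c ≠ 0 := norm_pos_iff.1 (hρ0.trans_le hc)
      have hci : CircleIntegrable (fun x : ℂ => s * log ‖x - 0‖) c r :=
        (circleIntegrable_log_norm_sub_const r).const_fun_smul (a := s)
      have e1 : circleAverage (fun x : ℂ => s * log ‖x - 0‖) c r =
        s * circleAverage (fun x : ℂ => log ‖x - 0‖) c r :=
        circleAverage_fun_mul_left _ _ _ _
      have h1 := log_le_circleAverage_log hc0 hr
      calc s * log (max ‖c‖ ρ) + b ≤ s * circleAverage (fun x : ℂ => log ‖x - 0‖) c r + b := by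
            rw [max_eq_left hc]
            gcongr
            simpa using h1
        _ = circleAverage (fun x : ℂ => s * log ‖x - 0‖ + b) c r := by
            rw [circleAverage_fun_add hci (continuous_circleIntegrable continuous_const c r), e1,
              circleAverage_const]
        _ ≤ _ := by
            refine circleAverage_mono_of_ne hr.ne'
              (hci.add (continuous_circleIntegrable continuous_const c r))
              (continuous_circleIntegrable hcont c r) 0 fun x hx => ?_
            simpa using hge2 x hx
  · rcases le_total ‖w‖ ρ with hw | hw
    · rw [max_eq_right hw, hρb]
      exact hφ0 w
    · rw [max_eq_left hw]
      exact h w (norm_pos_iff.1 (hρ0.trans_le hw))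
  · filter_upwards [tendsto_norm_cobounded_atTop.eventually_ge_atTop (max 1 ρ)] with w hw
    rw [max_eq_left ((le_max_right _ _).trans hw)]
    have h1 := log_nonneg ((le_max_left _ _).trans hw)
    have := le_abs_self b
    nlinarith

end EquilibriumPotential

/-! ### Regularity of the equilibrium potential of a radial weight -/

section RadialEquilibriumPotential

open MeasureTheory Filter Real Metric Set RandomPoly

variable {φ : ℂ → ℝ}

theorem equilibriumPotential_le_of_forall (hφ0 : ∀ z, 0 ≤ φ z) {z : ℂ} {y : ℝ}
    (h : ∀ w : ℂ → ℝ, UpperSemicontinuous w → HasSubMean w → (∀ z, w z ≤ φ z) →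
      (∃ C : ℝ, ∀ᶠ z in Bornology.cobounded ℂ, w z ≤ log ‖z‖ + C) → w z ≤ y) :
    equilibriumPotential φ z ≤ y := by
  refine csSup_le ⟨0, fun _ => ((0 : ℝ) : EReal), ?_, ?_, rfl⟩ ?_
  · refine ⟨⟨continuous_const.upperSemicontinuous, fun _ => EReal.coe_ne_top _, ?_⟩, 0, ?_⟩
    · intro c r hr g hg hgs
      rw [EReal.coe_le_coe_iff]
      refine circleAverage_nonneg_of_nonneg fun z hz => ?_
      rw [abs_of_pos hr] at hz
      exact EReal.coe_le_coe_iff.1 (hgs z hz)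
    · filter_upwards [tendsto_norm_cobounded_atTop.eventually_ge_atTop 1] with z hz
      rw [EReal.coe_le_coe_iff, add_zero]
      exact log_nonneg hz
  · exact fun w => EReal.coe_le_coe_iff.2 (hφ0 w)
  · rintro x ⟨u, hu, huφ, hx⟩
    obtain ⟨w, h1, h2, h3, h4, h5⟩ := exists_real_competitor hφ0 hu huφ
    exact (h5 z x hx).trans (h w h1 h2 h3 h4)

theorem equilibriumPotential_le (hφ0 : ∀ z, 0 ≤ φ z) (z : ℂ) : equilibriumPotential φ z ≤ φ z :=
  equilibriumPotential_le_of_forall hφ0 fun _ _ _ h _ => h z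

theorem equilibriumPotential_le_of_norm_le (hφ0 : ∀ z, 0 ≤ φ z)
    (hφr : ∀ z : ℂ, φ z = φ (‖z‖ : ℂ)) {z w : ℂ} (h : ‖z‖ ≤ ‖w‖) :
    equilibriumPotential φ z ≤ φ w := by
  refine equilibriumPotential_le_of_forall hφ0 fun u h1 h2 h3 _ =>
    h2.le_of_norm_le h1 (fun y hy => ?_) h
  rw [hφr w, ← hy, ← hφr y]
  exact h3 y

theorem equilibriumPotential_le_affine (hφ0 : ∀ z, 0 ≤ φ z)
    (hφr : ∀ z : ℂ, φ z = φ (‖z‖ : ℂ)) {z z₁ z₂ : ℂ} (hz₁ : z₁ ≠ 0) (h₁ : ‖z₁‖ ≤ ‖z‖)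
    (h₂ : ‖z‖ ≤ ‖z₂‖) {a b : ℝ} (hb₁ : φ z₁ ≤ a * log ‖z₁‖ + b) (hb₂ : φ z₂ ≤ a * log ‖z₂‖ + b) :
    equilibriumPotential φ z ≤ a * log ‖z‖ + b := by
  refine equilibriumPotential_le_of_forall hφ0 fun u h1 h2 h3 _ =>
    h2.le_of_annulus h1 (norm_pos_iff.2 hz₁) (fun y hy => ?_) (fun y hy => ?_) h₁ h₂
  · refine (h3 y).trans (le_trans (le_of_eq ?_) hb₁)
    rw [hφr z₁, ← hy, ← hφr y]
  · refine (h3 y).trans (le_trans (le_of_eq ?_) hb₂)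
    rw [hφr z₂, ← hy, ← hφr y]

/-- The bound by lines of slope `1`: annuli whose outer radius tends to infinity are used with slope
`1 + κ`, which wins over the growth `log |z| + C` of the competitors. -/
theorem equilibriumPotential_le_add_log (hφ0 : ∀ z, 0 ≤ φ z)
    (hφr : ∀ z : ℂ, φ z = φ (‖z‖ : ℂ)) {z z₁ : ℂ} (hz₁ : z₁ ≠ 0) (h₁ : ‖z₁‖ ≤ ‖z‖) :
    equilibriumPotential φ z ≤ φ z₁ + (log ‖z‖ - log ‖z₁‖) := by
  refine equilibriumPotential_le_of_forall hφ0 fun u h1 h2 h3 ⟨C, hC⟩ => ?_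
  have key : ∀ κ : ℝ, 0 < κ → u z ≤ φ z₁ + (1 + κ) * (log ‖z‖ - log ‖z₁‖) := by
    intro κ hκ
    set b := φ z₁ - (1 + κ) * log ‖z₁‖ with hb
    have hlog : ∀ᶠ y in Bornology.cobounded ℂ, u y ≤ (1 + κ) * log ‖y‖ + b := by
      have ht : Tendsto (fun y : ℂ => κ * log ‖y‖) (Bornology.cobounded ℂ) atTop :=
        (tendsto_log_atTop.comp tendsto_norm_cobounded_atTop).const_mul_atTop hκ
      filter_upwards [hC, ht.eventually_ge_atTop (C - b)] with y hy1 hy2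
      linarith
    obtain ⟨s, hs, hs'⟩ := (hasBasis_cobounded_norm.eventually_iff).1 hlog
    have := h2.le_of_annulus h1 (r₁ := ‖z₁‖) (r₂ := max s ‖z‖) (a := 1 + κ) (b := b)
      (norm_pos_iff.2 hz₁) (fun y hy => ?_) (fun y hy => ?_) h₁ (le_max_right _ _)
    · rw [hb] at this
      linarith
    · have e : φ y = φ z₁ := by rw [hφr z₁, ← hy, ← hφr y]
      have := h3 y
      rw [hb]
      linarith
    · rw [← hy]
      refine hs' ?_
      have := le_max_left s ‖z‖
      simp only [mem_ofPred_eq]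
      linarith
  have hlim : Tendsto (fun κ : ℝ => φ z₁ + (1 + κ) * (log ‖z‖ - log ‖z₁‖)) (𝓝[>] 0)
      (𝓝 (φ z₁ + (1 + 0) * (log ‖z‖ - log ‖z₁‖))) :=
    (Continuous.tendsto (by fun_prop) 0).mono_left nhdsWithin_le_nhds
  rw [add_zero, one_mul] at hlim
  exact ge_of_tendsto hlim (eventually_mem_nhdsWithin.mono fun κ hκ => key κ hκ)

/-- The equilibrium potential of a radial weight is, in the variable `log |z|`, the largest convex
minorant of `φ` with slopes in `[0, 1]`: through every point of its graph passes a supporting line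
that stays below `φ`. -/
theorem exists_supporting_line (hφ0 : ∀ z, 0 ≤ φ z) (hφr : ∀ z : ℂ, φ z = φ (‖z‖ : ℂ)) {z₀ : ℂ}
    (hz₀ : z₀ ≠ 0) :
    ∃ s : ℝ, 0 ≤ s ∧ s ≤ 1 ∧ ∀ z, z ≠ 0 →
      s * log ‖z‖ + (equilibriumPotential φ z₀ - s * log ‖z₀‖) ≤ φ z := by
  set x := equilibriumPotential φ z₀ with hx
  have hp₀ := norm_pos_iff.2 hz₀
  -- the slope must dominate `A` and be dominated by the corresponding quotients on the outside
  set A : Set ℝ := insert 0 {q | ∃ z, z ≠ 0 ∧ ‖z‖ < ‖z₀‖ ∧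
    q = (x - φ z) / (log ‖z₀‖ - log ‖z‖)} with hA
  have hA1 : ∀ q ∈ A, q ≤ 1 := by
    rintro q (rfl | ⟨z, hz, hlt, rfl⟩)
    · exact zero_le_one
    · have := log_lt_log (norm_pos_iff.2 hz) hlt
      rw [div_le_one (by linarith)]
      linarith [equilibriumPotential_le_add_log hφ0 hφr hz hlt.le]
  have hAout : ∀ w : ℂ, ‖z₀‖ < ‖w‖ → ∀ q ∈ A, q ≤ (φ w - x) / (log ‖w‖ - log ‖z₀‖) := by
    intro w hw
    have hw' := log_lt_log hp₀ hw
    rintro q (rfl | ⟨z, hz, hlt, rfl⟩)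
    · exact div_nonneg (sub_nonneg.2 (equilibriumPotential_le_of_norm_le hφ0 hφr hw.le))
        (by linarith)
    · have hz' := log_lt_log (norm_pos_iff.2 hz) hlt
      have hd : log ‖w‖ - log ‖z‖ ≠ 0 := by linarith
      have h3 := equilibriumPotential_le_affine hφ0 hφr hz hlt.le hw.le
        (a := (φ w - φ z) / (log ‖w‖ - log ‖z‖))
        (b := φ z - (φ w - φ z) / (log ‖w‖ - log ‖z‖) * log ‖z‖) (by linarith)
        (by have : (φ w - φ z) / (log ‖w‖ - log ‖z‖) * (log ‖w‖ - log ‖z‖) = φ w - φ z :=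
              div_mul_cancel₀ _ hd
            linarith)
      rw [← hx] at h3
      have h4 : x - φ z ≤ (φ w - φ z) * (log ‖z₀‖ - log ‖z‖) / (log ‖w‖ - log ‖z‖) := by
        rw [mul_div_right_comm]
        linarith
      rw [le_div_iff₀ (by linarith)] at h4
      rw [div_le_div_iff₀ (by linarith) (by linarith)]
      linarith
  have hAne : A.Nonempty := ⟨0, mem_insert _ _⟩
  have hAb : BddAbove A := ⟨1, hA1⟩
  refine ⟨sSup A, le_csSup hAb (mem_insert _ _), csSup_le hAne hA1, fun z hz => ?_⟩
  rcases lt_trichotomy ‖z‖ ‖z₀‖ with h | h | h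
  · have hl := log_lt_log (norm_pos_iff.2 hz) h
    have : (x - φ z) / (log ‖z₀‖ - log ‖z‖) ≤ sSup A :=
      le_csSup hAb (mem_insert_of_mem _ ⟨z, hz, h, rfl⟩)
    rw [div_le_iff₀ (by linarith)] at this
    linarith
  · rw [h]
    linarith [equilibriumPotential_le_of_norm_le hφ0 hφr h.ge]
  · have hl := log_lt_log hp₀ h
    have : sSup A ≤ (φ z - x) / (log ‖z‖ - log ‖z₀‖) := csSup_le hAne (hAout z h)
    rw [le_div_iff₀ (by linarith)] at this
    linarith

theorem abs_equilibriumPotential_sub_le (hφc : Continuous φ) (hφ0 : ∀ z, 0 ≤ φ z)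
    (hφr : ∀ z : ℂ, φ z = φ (‖z‖ : ℂ)) {z w : ℂ} (hz : z ≠ 0) (hw : w ≠ 0) :
    |equilibriumPotential φ z - equilibriumPotential φ w| ≤ |log ‖z‖ - log ‖w‖| := by
  have key : ∀ z w : ℂ, z ≠ 0 → w ≠ 0 →
      equilibriumPotential φ z - equilibriumPotential φ w ≤ |log ‖z‖ - log ‖w‖| := by
    intro z w hz hw
    obtain ⟨s, hs0, hs1, hs⟩ := exists_supporting_line hφ0 hφr hz
    have h1 := log_le_equilibriumPotential hφc hφ0 hs0 hs1 hs hw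
    have h2 : s * (log ‖z‖ - log ‖w‖) ≤ 1 * |log ‖z‖ - log ‖w‖| :=
      (mul_le_mul_of_nonneg_left (le_abs_self _) hs0).trans
        (mul_le_mul_of_nonneg_right hs1 (abs_nonneg _))
    linarith
  rw [abs_sub_le_iff]
  refine ⟨key z w hz hw, ?_⟩
  rw [abs_sub_comm]
  exact key w z hw hz

theorem continuous_equilibriumPotential (hφc : Continuous φ) (hφ0 : ∀ z, 0 ≤ φ z)
    (hφr : ∀ z : ℂ, φ z = φ (‖z‖ : ℂ)) : Continuous (equilibriumPotential φ) := by
  rw [continuous_iff_continuousAt]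
  intro z
  rcases eq_or_ne z 0 with rfl | hz
  · -- near the origin the potential lies between `inf φ` and `inf φ + κ`
    rw [Metric.continuousAt_iff']
    intro κ hκ
    have hbdd : BddBelow (range φ) := ⟨0, by rintro _ ⟨w, rfl⟩; exact hφ0 w⟩
    have hlow : ∀ w, sInf (range φ) ≤ equilibriumPotential φ w :=
      const_le_equilibriumPotential fun w => csInf_le hbdd ⟨w, rfl⟩
    have hup : equilibriumPotential φ 0 ≤ sInf (range φ) := by
      refine le_csInf (range_nonempty φ) ?_
      rintro _ ⟨w, rfl⟩
      exact equilibriumPotential_le_of_norm_le hφ0 hφr (by simp)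
    obtain ⟨_, ⟨w, rfl⟩, hw⟩ := exists_lt_of_csInf_lt (range_nonempty φ)
      (lt_add_of_pos_right (sInf (range φ)) hκ)
    have hev : ∀ᶠ y in 𝓝 (0 : ℂ), equilibriumPotential φ y < sInf (range φ) + κ := by
      rcases eq_or_ne w 0 with rfl | hw0
      · filter_upwards [hφc.continuousAt.eventually_lt_const hw] with y hy
        exact (equilibriumPotential_le hφ0 y).trans_lt hy
      · filter_upwards [ball_mem_nhds (0 : ℂ) (norm_pos_iff.2 hw0)] with y hy
        rw [mem_ball_zero_iff] at hy
        exact (equilibriumPotential_le_of_norm_le hφ0 hφr hy.le).trans_lt hw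
    filter_upwards [hev] with y hy
    rw [Real.dist_eq, abs_lt]
    have h1 := hlow y
    have h2 := hlow 0
    constructor <;> linarith
  · rw [ContinuousAt, tendsto_iff_norm_sub_tendsto_zero]
    have hlog : Tendsto (fun y : ℂ => |log ‖y‖ - log ‖z‖|) (𝓝 z) (𝓝 0) := by
      have h1 : ContinuousAt (fun y : ℂ => |log ‖y‖ - log ‖z‖|) z :=
        ((continuous_norm.continuousAt.log (norm_ne_zero_iff.2 hz)).sub continuousAt_const).abs
      simpa [ContinuousAt] using h1
    refine squeeze_zero' (Eventually.of_forall fun _ => norm_nonneg _) ?_ hlog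
    filter_upwards [isOpen_ne.mem_nhds hz] with y hy
    exact abs_equilibriumPotential_sub_le hφc hφ0 hφr hy hz

theorem equilibriumPotential_le_circleAverage (hφc : Continuous φ) (hφ0 : ∀ z, 0 ≤ φ z)
    (hφr : ∀ z : ℂ, φ z = φ (‖z‖ : ℂ)) (c : ℂ) {r : ℝ} (hr : 0 < r) :
    equilibriumPotential φ c ≤ circleAverage (equilibriumPotential φ) c r := by
  have hc := continuous_equilibriumPotential hφc hφ0 hφr
  refine Real.sSup_le ?_ (circleAverage_nonneg_of_nonneg fun z _ =>
    equilibriumPotential_nonneg hφ0 z)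
  rintro x ⟨u, hu, huφ, hx⟩
  rw [← EReal.coe_le_coe_iff, ← hx]
  refine hu.1.le_mean c r hr _ hc fun z _ => ?_
  rcases eq_or_ne (u z) ⊥ with h | h
  · rw [h]
    exact bot_le
  rw [← EReal.coe_toReal (hu.1.ne_top z) h, EReal.coe_le_coe_iff]
  refine le_csSup ⟨φ z, ?_⟩ ⟨u, hu, huφ, (EReal.coe_toReal (hu.1.ne_top z) h).symm⟩
  rintro y ⟨v, -, hv, hy⟩
  rw [← EReal.coe_le_coe_iff, ← hy]
  exact hv z

theorem equilibriumPotential_le_log_add (hφ0 : ∀ z, 0 ≤ φ z)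
    (hφr : ∀ z : ℂ, φ z = φ (‖z‖ : ℂ)) {z : ℂ} (hz : 1 ≤ ‖z‖) :
    equilibriumPotential φ z ≤ log ‖z‖ + φ 1 := by
  have := equilibriumPotential_le_add_log hφ0 hφr one_ne_zero (z := z) (by simpa using hz)
  simp only [norm_one, log_one, sub_zero] at this
  linarith

end RadialEquilibriumPotential

/-! ### The Laplacian of the equilibrium potential -/

section LaplacianOfEquilibriumPotential

open MeasureTheory Filter Real Metric Set RandomPoly
open scoped CompactlySupported

theorem tendsto_along_ultrafilter_of_abs_le (𝒰 : Ultrafilter ℝ) {g : ℝ → ℝ} {C : ℝ}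
    (h : ∀ᶠ r in (𝒰 : Filter ℝ), |g r| ≤ C) : ∃ x, Tendsto g 𝒰 (𝓝 x) := by
  have hmem : Icc (-C) C ∈ 𝒰.map g := h.mono fun r hr => abs_le.1 hr
  obtain ⟨x, -, hx⟩ := isCompact_Icc.ultrafilter_le_nhds' (𝒰.map g) hmem
  exact ⟨x, hx⟩

theorem exists_smooth_cutoff {K O : Set ℂ} (hK : IsCompact K) (hO : IsOpen O) (hKO : K ⊆ O) :
    ∃ ψ : ℂ → ℝ, ContDiff ℝ ∞ ψ ∧ HasCompactSupport ψ ∧ (∀ z, 0 ≤ ψ z) ∧ (∀ z, ψ z ≤ 1) ∧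
      (∀ z ∈ K, ψ z = 1) ∧ ∀ z ∉ O, ψ z = 0 := by
  obtain ⟨W, hW, hKW, hWO, hWc⟩ := exists_open_between_and_isCompact_closure hK hO hKO
  obtain ⟨ψ, hd, hr, hs, h1⟩ := exists_contMDiff_support_eq_eq_one_iff
    (modelWithCornersSelf ℝ ℂ) (n := (⊤ : ℕ∞)) hW hK.isClosed hKW
  refine ⟨ψ, hd.contDiff, ?_, fun z => (hr ⟨z, rfl⟩).1, fun z => (hr ⟨z, rfl⟩).2,
    fun z hz => (h1 z).1 hz, fun z hz => ?_⟩
  · unfold HasCompactSupport tsupport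
    rwa [hs]
  · by_contra hne
    have hzW : z ∈ W := hs ▸ (Function.mem_support.2 hne)
    exact hz (hWO (subset_closure hzW))

/-- A continuous function whose circle averages satisfy `0 ≤ A_r V - V ≤ M r ^ 2` has a Laplacian
which is a measure with density at most `4 M`. The measure is obtained from a weak limit, along
an ultrafilter `r → 0`, of the densities `4 (A_r V - V) / r ^ 2`. -/
theorem exists_isDistribLaplacian {V : ℂ → ℝ} (hV : Continuous V) {M : ℝ}
    (h : ∀ᶠ r in 𝓝[>] (0 : ℝ), ∀ z, 0 ≤ circleAverage V z r - V z ∧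
      circleAverage V z r - V z ≤ M * r ^ 2) :
    ∃ μ : Measure ℂ, IsDistribLaplacian V μ ∧ μ ≪ volume := by
  set 𝒰 : Ultrafilter ℝ := Ultrafilter.of (𝓝[>] (0 : ℝ)) with h𝒰
  have h𝒰le : (𝒰 : Filter ℝ) ≤ 𝓝[>] (0 : ℝ) := Ultrafilter.of_le _
  set g : ℝ → ℂ → ℝ := fun r z => 4 / r ^ 2 * (circleAverage V z r - V z) with hg
  have hgc : ∀ r, Continuous (g r) := fun r => by
    have := continuous_circleAverage_center hV r
    fun_prop
  have hgb : ∀ᶠ r in (𝒰 : Filter ℝ), ∀ z, 0 ≤ g r z ∧ g r z ≤ 4 * M := by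
    filter_upwards [h𝒰le h, h𝒰le self_mem_nhdsWithin] with r hr hr0 z
    have hr0 : 0 < r := hr0
    refine ⟨mul_nonneg (by positivity) (hr z).1, ?_⟩
    rw [hg]
    simp only
    rw [div_mul_eq_mul_div, div_le_iff₀ (by positivity)]
    linarith [(hr z).2]
  have hint : ∀ (f : C_c(ℂ, ℝ)) (r : ℝ), Integrable fun z => g r z * f z := fun f r =>
    ((hgc r).mul f.continuous).integrable_of_hasCompactSupport f.hasCompactSupport.mul_left
  have hfint : ∀ f : C_c(ℂ, ℝ), Integrable fun z => f z := fun f =>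
    f.continuous.integrable_of_hasCompactSupport f.hasCompactSupport
  have hlim : ∀ f : C_c(ℂ, ℝ), ∃ x, Tendsto (fun r => ∫ z, g r z * f z) 𝒰 (𝓝 x) := fun f => by
    refine tendsto_along_ultrafilter_of_abs_le 𝒰 (C := ∫ z, 4 * M * |f z|) ?_
    filter_upwards [hgb] with r hr
    refine (abs_integral_le_integral_abs).trans (integral_mono (hint f r).abs
      ((hfint f).abs.const_mul _) fun z => ?_)
    simp only [abs_mul]
    rw [abs_of_nonneg (hr z).1]
    exact mul_le_mul_of_nonneg_right (hr z).2 (abs_nonneg _)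
  choose L hL using hlim
  let Λ₀ : C_c(ℂ, ℝ) →ₗ[ℝ] ℝ :=
    { toFun := L
      map_add' := fun f₁ f₂ => by
        refine tendsto_nhds_unique (hL (f₁ + f₂)) (((hL f₁).add (hL f₂)).congr fun r => ?_)
        rw [← integral_add (hint f₁ r) (hint f₂ r)]
        refine integral_congr_ae (Eventually.of_forall fun z => ?_)
        simp [mul_add]
      map_smul' := fun c f => by
        refine tendsto_nhds_unique (hL (c • f)) (((hL f).const_mul c).congr fun r => ?_)
        rw [← integral_const_mul]
        refine integral_congr_ae (Eventually.of_forall fun z => ?_)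
        simp only [CompactlySupportedContinuousMap.coe_smul, Pi.smul_apply, smul_eq_mul]
        ring }
  have hΛpos : ∀ f : C_c(ℂ, ℝ), 0 ≤ f → 0 ≤ Λ₀ f := fun f hf => by
    refine ge_of_tendsto (hL f) ?_
    filter_upwards [hgb] with r hr
    exact integral_nonneg fun z => mul_nonneg (hr z).1 (hf z)
  have hΛle : ∀ f : C_c(ℂ, ℝ), 0 ≤ f → Λ₀ f ≤ 4 * M * ∫ z, f z := fun f hf => by
    refine le_of_tendsto (hL f) ?_
    filter_upwards [hgb] with r hr
    rw [← integral_const_mul]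
    exact integral_mono (hint f r) ((hfint f).const_mul _)
      fun z => mul_le_mul_of_nonneg_right (hr z).2 (hf z)
  set Λ : C_c(ℂ, ℝ) →ₚ[ℝ] ℝ := PositiveLinearMap.mk₀ Λ₀ hΛpos with hΛ
  set μ : Measure ℂ := RealRMK.rieszMeasure Λ with hμ
  have hreg : μ.Regular := by
    rw [hμ]
    unfold RealRMK.rieszMeasure
    infer_instance
  have hopen : ∀ O : Set ℂ, IsOpen O → μ O ≤ ENNReal.ofReal (4 * M) * volume O := by
    intro O hO
    rw [hO.measure_eq_iSup_isCompact]
    refine iSup_le fun K => iSup_le fun hKO => iSup_le fun hK => ?_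
    obtain ⟨ψ, hd, hc, h0, hle, h1, hz0⟩ := exists_smooth_cutoff hK hO hKO
    let f : C_c(ℂ, ℝ) := ⟨⟨ψ, hd.continuous⟩, hc⟩
    have hM : 0 ≤ M := by
      obtain ⟨r, hr⟩ := hgb.exists
      linarith [(hr 0).1, (hr 0).2]
    calc μ K ≤ ENNReal.ofReal (Λ f) :=
          RealRMK.rieszMeasure_le_of_eq_one Λ (f := f) h0 hK h1
      _ ≤ ENNReal.ofReal (4 * M * ∫ z, f z) := ENNReal.ofReal_le_ofReal (hΛle f h0)
      _ = ENNReal.ofReal (4 * M) * ∫⁻ z, ENNReal.ofReal (f z) := by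
          rw [ENNReal.ofReal_mul (by positivity),
            ofReal_integral_eq_lintegral_ofReal (hfint f) (Eventually.of_forall h0)]
      _ ≤ ENNReal.ofReal (4 * M) * ∫⁻ z, O.indicator 1 z := by
          gcongr with z
          by_cases hz : z ∈ O
          · have h2 : f z ≤ 1 := hle z
            rw [indicator_of_mem hz]
            simpa using h2
          · have : f z = 0 := hz0 z hz
            simp [this]
      _ = _ := by rw [lintegral_indicator_one hO.measurableSet]
  refine ⟨μ, ⟨hV.locallyIntegrable, inferInstance, fun ψ hψ hψc => ?_⟩, fun S hS => ?_⟩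
  · let f : C_c(ℂ, ℝ) := ⟨⟨ψ, hψ.continuous⟩, hψc⟩
    have h1 : ∫ z, ψ z ∂μ = L f := RealRMK.integral_rieszMeasure Λ f
    rw [h1]
    exact tendsto_nhds_unique (hL f) ((tendsto_integral_circleAverage_sub hV.measurable
      hV.locallyIntegrable (hψ.of_le (by norm_cast)) hψc).mono_left h𝒰le)
  · refine le_antisymm (le_of_forall_pos_le_add fun κ hκ => ?_) zero_le
    rw [zero_add]
    have hC : ENNReal.ofReal (4 * M) + 1 ≠ ⊤ :=
      ENNReal.add_ne_top.2 ⟨ENNReal.ofReal_ne_top, ENNReal.one_ne_top⟩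
    obtain ⟨O, hSO, hO, hvol⟩ := S.exists_isOpen_le_add (volume : Measure ℂ)
      (ε := κ / (ENNReal.ofReal (4 * M) + 1)) (ENNReal.div_pos hκ.ne' hC).ne'
    rw [hS, zero_add] at hvol
    calc μ S ≤ μ O := measure_mono hSO
      _ ≤ ENNReal.ofReal (4 * M) * volume O := hopen O hO
      _ ≤ (ENNReal.ofReal (4 * M) + 1) * (κ / (ENNReal.ofReal (4 * M) + 1)) := by
          gcongr
          exact le_self_add
      _ = κ := ENNReal.mul_div_cancel (by simp) hC

theorem circleAverage_circleAverage_comm {V : ℂ → ℝ} (hV : Continuous V) (c : ℂ) (r ρ : ℝ) :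
    circleAverage (fun z => circleAverage V z r) c ρ =
      circleAverage (fun z => circleAverage V z ρ) c r := by
  simp only [circleAverage, smul_eq_mul, intervalIntegral.integral_const_mul]
  have hcont : Continuous (Function.uncurry fun θ η => V (circleMap (circleMap c ρ θ) r η)) := by
    unfold circleMap Function.uncurry
    fun_prop
  congr 2
  rw [intervalIntegral_intervalIntegral_swap]
  · refine intervalIntegral.integral_congr fun θ _ => intervalIntegral.integral_congr fun η _ => ?_
    simp only [circleMap]
    congr 1
    ring
  · exact (hcont.continuousOn.integrableOn_compact (isCompact_uIcc.prod isCompact_uIcc)).mono_set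
      (prod_mono uIoc_subset_uIcc uIoc_subset_uIcc)

variable {φ : ℂ → ℝ}

theorem circleAverage_equilibriumPotential_le_log (hφc : Continuous φ) (hφ0 : ∀ z, 0 ≤ φ z)
    (hφr : ∀ z : ℂ, φ z = φ (‖z‖ : ℂ)) {r : ℝ} (hr : r ∈ Ioc (0 : ℝ) 1) {z : ℂ} (hz : 2 ≤ ‖z‖) :
    circleAverage (equilibriumPotential φ) z r ≤ log ‖z‖ + (log 2 + φ 1) := by
  refine circleAverage_mono_on_of_le_circle (continuous_circleIntegrable
    (continuous_equilibriumPotential hφc hφ0 hφr) z r) fun w hw => ?_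
  rw [mem_sphere_iff_norm, abs_of_pos hr.1] at hw
  have h1 := norm_sub_norm_le z w
  have h2 := norm_sub_norm_le w z
  rw [norm_sub_rev] at h1
  have h3 : 1 ≤ ‖w‖ := by linarith [hr.2]
  refine (equilibriumPotential_le_log_add hφ0 hφr h3).trans ?_
  have h4 : log ‖w‖ ≤ log (‖z‖ * 2) := log_le_log (by linarith) (by linarith [hr.2])
  rw [log_mul (by linarith) two_ne_zero] at h4
  linarith

/-- The circle averages of the equilibrium potential, lowered by a multiple of `r ^ 2`, are
competitors for the equilibrium potential. This is the `C^{1,1}` regularity that is needed. -/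
theorem exists_circleAverage_sub_equilibriumPotential_le (hφ : ContDiff ℝ 2 φ)
    (hφ0 : ∀ z, 0 ≤ φ z) (hφr : ∀ z : ℂ, φ z = φ (‖z‖ : ℂ))
    (hφg : ∃ δ : ℝ, 0 < δ ∧ ∀ᶠ z in Bornology.cobounded ℂ, (1 + δ) * log ‖z‖ ≤ φ z) :
    ∃ M : ℝ, ∀ r ∈ Ioc (0 : ℝ) 1, ∀ z,
      circleAverage (equilibriumPotential φ) z r - equilibriumPotential φ z ≤ M * r ^ 2 := by
  obtain ⟨δ, hδ, hg⟩ := hφg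
  have hφc := hφ.continuous
  have hVc := continuous_equilibriumPotential hφc hφ0 hφr
  have hlarge : ∀ᶠ z in Bornology.cobounded ℂ, 2 ≤ ‖z‖ ∧ log ‖z‖ + (log 2 + φ 1) ≤ φ z := by
    have ht : Tendsto (fun y : ℂ => δ * log ‖y‖) (Bornology.cobounded ℂ) atTop :=
      (tendsto_log_atTop.comp tendsto_norm_cobounded_atTop).const_mul_atTop hδ
    filter_upwards [hg, tendsto_norm_cobounded_atTop.eventually_ge_atTop 2,
      ht.eventually_ge_atTop (log 2 + φ 1)] with z h1 h2 h3
    exact ⟨h2, by linarith⟩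
  obtain ⟨R, -, hR⟩ := (hasBasis_cobounded_norm.eventually_iff).1 hlarge
  obtain ⟨M, hM0, hM⟩ := exists_abs_circleAverage_sub_le hφ R
  refine ⟨M, fun r hr z => ?_⟩
  have hAc := continuous_circleAverage_center hVc r
  have hMr : 0 ≤ M * r ^ 2 := by positivity
  have key := le_equilibriumPotential (φ := φ)
    (u := fun z => circleAverage (equilibriumPotential φ) z r - M * r ^ 2)
    (by fun_prop) (fun c ρ hρ => ?_) (fun w => ?_) ⟨log 2 + φ 1, ?_⟩ z
  · linarith
  · rw [circleAverage_fun_sub (continuous_circleIntegrable hAc c ρ)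
      (continuous_circleIntegrable continuous_const c ρ), circleAverage_const,
      circleAverage_circleAverage_comm hVc]
    refine sub_le_sub_right ?_ _
    exact circleAverage_mono (continuous_circleIntegrable hVc c r)
      (continuous_circleIntegrable (continuous_circleAverage_center hVc ρ) c r)
      fun w _ => equilibriumPotential_le_circleAverage hφc hφ0 hφr w hρ
  · rcases le_or_gt R ‖w‖ with hw | hw
    · obtain ⟨h2, h3⟩ := hR hw
      have := circleAverage_equilibriumPotential_le_log hφc hφ0 hφr hr h2
      linarith
    · have h1 := hM w (by simpa using hw.le) r hr
      have h2 : circleAverage (equilibriumPotential φ) w r ≤ circleAverage φ w r :=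
        circleAverage_mono (continuous_circleIntegrable hVc w r)
          (continuous_circleIntegrable hφc w r) fun y _ => equilibriumPotential_le hφ0 y
      have := (abs_le.1 h1).2
      linarith
  · filter_upwards [tendsto_norm_cobounded_atTop.eventually_ge_atTop 2] with w hw
    have := circleAverage_equilibriumPotential_le_log hφc hφ0 hφr hr hw
    linarith

/-- The equilibrium measure really is the Laplacian of the equilibrium potential, and it is
absolutely continuous. -/
theorem laplacianMeasure_equilibriumPotential (hφ : ContDiff ℝ 2 φ)
    (hφ0 : ∀ z, 0 ≤ φ z) (hφr : ∀ z : ℂ, φ z = φ (‖z‖ : ℂ))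
    (hφg : ∃ δ : ℝ, 0 < δ ∧ ∀ᶠ z in Bornology.cobounded ℂ, (1 + δ) * log ‖z‖ ≤ φ z) :
    IsDistribLaplacian (equilibriumPotential φ) (laplacianMeasure (equilibriumPotential φ)) ∧
      laplacianMeasure (equilibriumPotential φ) ≪ volume := by
  obtain ⟨M, hM⟩ := exists_circleAverage_sub_equilibriumPotential_le hφ hφ0 hφr hφg
  have hφc := hφ.continuous
  obtain ⟨μ, hμ, hμv⟩ := exists_isDistribLaplacian (continuous_equilibriumPotential hφc hφ0 hφr)
    (M := M) (by
      filter_upwards [Ioc_mem_nhdsGT (zero_lt_one' ℝ)] with r hr z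
      exact ⟨sub_nonneg.2 (equilibriumPotential_le_circleAverage hφc hφ0 hφr z hr.1), hM r hr z⟩)
  have hex : ∃ μ, IsDistribLaplacian (equilibriumPotential φ) μ := ⟨μ, hμ⟩
  have hspec : IsDistribLaplacian (equilibriumPotential φ)
      (laplacianMeasure (equilibriumPotential φ)) := by
    unfold laplacianMeasure
    rw [dif_pos hex]
    exact hex.choose_spec
  exact ⟨hspec, hspec.unique hμ ▸ hμv⟩

end LaplacianOfEquilibriumPotential

/-! ### Asymptotics of the normalizing constants -/

section NormalizingConstants

open MeasureTheory Filter Real Metric Set RandomPoly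

variable {φ : ℂ → ℝ}

/-- The largest `b` with `s log |z| + b ≤ φ z` for all `z ≠ 0`; up to sign, the Legendre transform of
`t ↦ φ (e ^ t)` at `s`. -/
noncomputable def legendreHeight (φ : ℂ → ℝ) (s : ℝ) : ℝ :=
  sInf ((fun z : ℂ => φ z - s * log ‖z‖) '' {0}ᶜ)

theorem le_legendreHeight {s b : ℝ} (h : ∀ z, z ≠ 0 → s * log ‖z‖ + b ≤ φ z) :
    b ≤ legendreHeight φ s := by
  refine le_csInf ⟨_, mem_image_of_mem _ (show (1 : ℂ) ∈ ({0}ᶜ : Set ℂ) by simp)⟩ ?_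
  rintro _ ⟨z, hz, rfl⟩
  have := h z hz
  simp only
  linarith

theorem bddBelow_legendreHeight (hφ0 : ∀ z, 0 ≤ φ z)
    (hφg : ∃ δ : ℝ, 0 < δ ∧ ∀ᶠ z in Bornology.cobounded ℂ, (1 + δ) * log ‖z‖ ≤ φ z) {s : ℝ}
    (hs0 : 0 ≤ s) (hs1 : s ≤ 1) : BddBelow ((fun z : ℂ => φ z - s * log ‖z‖) '' {0}ᶜ) := by
  obtain ⟨δ, hδ, hg⟩ := hφg
  obtain ⟨R, -, hR⟩ := (hasBasis_cobounded_norm.eventually_iff).1 hg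
  set R' := max R 1 with hR'
  have hl : 0 ≤ log R' := log_nonneg (le_max_right _ _)
  refine ⟨-log R', ?_⟩
  rintro _ ⟨z, hz, rfl⟩
  have hz' : z ≠ 0 := hz
  simp only
  rcases le_total R' ‖z‖ with h | h
  · have h1 := hR ((le_max_left R 1).trans h : R ≤ ‖z‖)
    have h2 : 0 ≤ log ‖z‖ := log_nonneg ((le_max_right R 1).trans h)
    nlinarith [mul_nonneg hδ.le h2]
  · have h1 : log ‖z‖ ≤ log R' := log_le_log (norm_pos_iff.2 hz') h
    have h2 : s * log ‖z‖ ≤ s * log R' := mul_le_mul_of_nonneg_left h1 hs0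
    nlinarith [hφ0 z]

theorem mul_log_add_legendreHeight_le (hφ0 : ∀ z, 0 ≤ φ z)
    (hφg : ∃ δ : ℝ, 0 < δ ∧ ∀ᶠ z in Bornology.cobounded ℂ, (1 + δ) * log ‖z‖ ≤ φ z) {s : ℝ}
    (hs0 : 0 ≤ s) (hs1 : s ≤ 1) {z : ℂ} (hz : z ≠ 0) :
    s * log ‖z‖ + legendreHeight φ s ≤ φ z := by
  have := csInf_le (bddBelow_legendreHeight hφ0 hφg hs0 hs1) (mem_image_of_mem _ hz)
  unfold legendreHeight
  linarith

/-- The weight `|z| ^ (2 j) e ^ (-2 n φ)` as an exponential. -/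
theorem weight_eq_exp {n j : ℕ} (hn : n ≠ 0) {z : ℂ} (hz : z ≠ 0) :
    ‖z‖ ^ (2 * j) * exp (-2 * n * φ z) = exp (2 * n * ((j / n : ℝ) * log ‖z‖ - φ z)) := by
  have h : ‖z‖ ^ (2 * j) = exp (2 * j * log ‖z‖) := by
    have : (2 * j * log ‖z‖ : ℝ) = ((2 * j : ℕ) : ℝ) * log ‖z‖ := by push_cast; ring
    rw [this, exp_nat_mul, exp_log (norm_pos_iff.2 hz)]
  have hn' : (n : ℝ) ≠ 0 := by exact_mod_cast hn
  rw [h, ← exp_add]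
  congr 1
  field_simp
  ring

/-- A fixed power of the weight gives an integrable majorant, uniform in the slope `s ∈ [0, 1]`. -/
theorem exists_integrable_weight (hφc : Continuous φ)
    (hφg : ∃ δ : ℝ, 0 < δ ∧ ∀ᶠ z in Bornology.cobounded ℂ, (1 + δ) * log ‖z‖ ≤ φ z) :
    ∃ m : ℕ, Integrable fun z : ℂ => exp (2 * m * (log (max 1 ‖z‖) - φ z)) := by
  obtain ⟨δ, hδ, hg⟩ := hφg
  obtain ⟨m, hm⟩ := exists_nat_ge (2 / δ)
  rw [div_le_iff₀ hδ] at hm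
  refine ⟨m, ?_⟩
  have hcont : Continuous fun z : ℂ => exp (2 * m * (log (max 1 ‖z‖) - φ z)) := by
    have : Continuous fun z : ℂ => log (max 1 ‖z‖) :=
      Continuous.log (by fun_prop) fun z => (lt_max_of_lt_left one_pos).ne'
    fun_prop
  refine hcont.locallyIntegrable.integrable_of_isBigO_cocompact
    (g := fun z : ℂ => (1 + ‖z‖) ^ (-4 : ℝ)) ?_
    ((integrable_one_add_norm (E := ℂ) (μ := volume) (r := 4)
      (by rw [Complex.finrank_real_complex]; norm_num)).integrableAtFilter _)
  refine Asymptotics.IsBigO.of_bound 16 ?_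
  rw [← cobounded_eq_cocompact]
  filter_upwards [hg, tendsto_norm_cobounded_atTop.eventually_ge_atTop 1] with z h1 h2
  have hl := log_nonneg h2
  have hp : 0 < ‖z‖ := by linarith
  rw [max_eq_right h2, norm_of_nonneg (exp_pos _).le, norm_of_nonneg (by positivity)]
  calc exp (2 * m * (log ‖z‖ - φ z)) ≤ exp (-4 * log ‖z‖) := by
        refine exp_le_exp.2 ?_
        have h3 : (m : ℝ) * (log ‖z‖ - φ z) ≤ m * (-(δ * log ‖z‖)) :=
          mul_le_mul_of_nonneg_left (by linarith) (Nat.cast_nonneg m)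
        have h4 : 2 * log ‖z‖ ≤ m * δ * log ‖z‖ := mul_le_mul_of_nonneg_right hm hl
        linarith
    _ = ‖z‖ ^ (-4 : ℝ) := by rw [rpow_def_of_pos hp, mul_comm]
    _ = 16 * (2 * ‖z‖) ^ (-4 : ℝ) := by
        rw [mul_rpow two_pos.le hp.le, ← mul_assoc]
        have : (16 : ℝ) * 2 ^ (-4 : ℝ) = 1 := by
          rw [rpow_neg two_pos.le]
          norm_num
        rw [this, one_mul]
    _ ≤ 16 * (1 + ‖z‖) ^ (-4 : ℝ) := by
        gcongr 16 * ?_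
        exact rpow_le_rpow_of_nonpos (by linarith) (by linarith) (by norm_num)

theorem natCast_div_mem {n j : ℕ} (hj : j ≤ n) : 0 ≤ (j / n : ℝ) ∧ (j / n : ℝ) ≤ 1 :=
  ⟨by positivity, div_le_one_of_le₀ (by exact_mod_cast hj) (by positivity)⟩

theorem exists_integral_weight_le (hφc : Continuous φ) (hφ0 : ∀ z, 0 ≤ φ z)
    (hφg : ∃ δ : ℝ, 0 < δ ∧ ∀ᶠ z in Bornology.cobounded ℂ, (1 + δ) * log ‖z‖ ≤ φ z) :
    ∃ K : ℝ, ∀ᶠ n : ℕ in atTop, ∀ j ≤ n,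
      Integrable (fun z : ℂ => ‖z‖ ^ (2 * j) * exp (-2 * n * φ z)) ∧
      ∫ z : ℂ, ‖z‖ ^ (2 * j) * exp (-2 * n * φ z) ≤
        K * exp (-2 * n * legendreHeight φ (j / n)) := by
  obtain ⟨m, hm⟩ := exists_integrable_weight hφc hφg
  set G : ℂ → ℝ := fun z => exp (2 * m * (log (max 1 ‖z‖) - φ z)) with hG
  refine ⟨exp (2 * m * φ 1) * ∫ z, G z, ?_⟩
  filter_upwards [eventually_ge_atTop m, eventually_gt_atTop 0] with n hnm hn j hj
  obtain ⟨hs0, hs1⟩ := natCast_div_mem hj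
  set s : ℝ := j / n with hs
  have hnm' : (m : ℝ) ≤ n := by exact_mod_cast hnm
  have hβ : legendreHeight φ s ≤ φ 1 := by
    simpa using mul_log_add_legendreHeight_le hφ0 hφg hs0 hs1 one_ne_zero
  have hle : ∀ᵐ z : ℂ, ‖z‖ ^ (2 * j) * exp (-2 * n * φ z) ≤
      exp (2 * m * φ 1) * exp (-2 * n * legendreHeight φ s) * G z := by
    filter_upwards [compl_mem_ae_iff.2 (measure_singleton (μ := (volume : Measure ℂ)) 0)] with z hz
    have hz : z ≠ 0 := hz
    rw [weight_eq_exp hn.ne' hz, hG, ← exp_add, ← exp_add, ← hs]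
    gcongr
    have h1 := mul_log_add_legendreHeight_le hφ0 hφg hs0 hs1 hz
    have h2 : s * log ‖z‖ ≤ log (max 1 ‖z‖) := by
      have h3 : log ‖z‖ ≤ log (max 1 ‖z‖) :=
        log_le_log (norm_pos_iff.2 hz) (le_max_right _ _)
      have h4 : 0 ≤ log (max 1 ‖z‖) := log_nonneg (le_max_left _ _)
      nlinarith
    have h5 : ((n : ℝ) - m) * (s * log ‖z‖ - φ z) ≤ (n - m) * (-legendreHeight φ s) :=
      mul_le_mul_of_nonneg_left (by linarith) (by linarith)
    have h6 : (m : ℝ) * (s * log ‖z‖) ≤ m * log (max 1 ‖z‖) := by gcongr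
    have h7 : (m : ℝ) * legendreHeight φ s ≤ m * φ 1 := by gcongr
    nlinarith
  have hi : Integrable fun z : ℂ => exp (2 * m * φ 1) * exp (-2 * n * legendreHeight φ s) * G z :=
    hm.const_mul _
  have hint : Integrable fun z : ℂ => ‖z‖ ^ (2 * j) * exp (-2 * n * φ z) := by
    refine hi.mono' (Continuous.aestronglyMeasurable (by fun_prop)) ?_
    filter_upwards [hle] with z hz
    rwa [norm_of_nonneg (by positivity)]
  refine ⟨hint, (integral_mono_ae hint hi hle).trans (le_of_eq ?_)⟩
  rw [integral_const_mul]
  ring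

theorem exists_le_integral_weight (hφc : Continuous φ) (hφ0 : ∀ z, 0 ≤ φ z)
    (hφr : ∀ z : ℂ, φ z = φ (‖z‖ : ℂ))
    (hφg : ∃ δ : ℝ, 0 < δ ∧ ∀ᶠ z in Bornology.cobounded ℂ, (1 + δ) * log ‖z‖ ≤ φ z)
    {η : ℝ} (hη : 0 < η) :
    ∃ k : ℝ, 0 < k ∧ ∀ n j : ℕ, n ≠ 0 → j ≤ n →
      Integrable (fun z : ℂ => ‖z‖ ^ (2 * j) * exp (-2 * n * φ z)) →
      k * exp (-2 * n * (legendreHeight φ (j / n) + η)) ≤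
        ∫ z : ℂ, ‖z‖ ^ (2 * j) * exp (-2 * n * φ z) := by
  -- near-minimizers of `φ - s log |z|` stay in a fixed disc
  obtain ⟨R, hR1, hR⟩ : ∃ R : ℝ, 1 ≤ R ∧ ∀ z : ℂ, R ≤ ‖z‖ → log ‖z‖ + (φ 1 + η) ≤ φ z := by
    obtain ⟨δ, hδ, hg⟩ := hφg
    have ht : Tendsto (fun y : ℂ => δ * log ‖y‖) (Bornology.cobounded ℂ) atTop :=
      (tendsto_log_atTop.comp tendsto_norm_cobounded_atTop).const_mul_atTop hδ
    obtain ⟨R, -, hR⟩ := (hasBasis_cobounded_norm.eventually_iff).1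
      (hg.and (ht.eventually_ge_atTop (φ 1 + η)))
    refine ⟨max R 1, le_max_right _ _, fun z hz => ?_⟩
    obtain ⟨h1, h2⟩ := hR ((le_max_left R 1).trans hz : R ≤ ‖z‖)
    linarith
  obtain ⟨ρ, hρ, hρφ⟩ := Metric.uniformContinuousOn_iff.1
    ((isCompact_closedBall (0 : ℂ) (R + 1)).uniformContinuousOn_of_continuous hφc.continuousOn)
    (η / 2) (by positivity)
  set ρ' := min ρ 1 with hρ'
  have hρ0 : 0 < ρ' := lt_min hρ one_pos
  refine ⟨volume.real (ball (0 : ℂ) (ρ' / 2)), ?_, fun n j hn hj hint => ?_⟩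
  · exact ENNReal.toReal_pos (measure_ball_pos _ _ (by positivity)).ne' measure_ball_lt_top.ne
  obtain ⟨hs0, hs1⟩ := natCast_div_mem hj
  set s : ℝ := j / n with hs
  obtain ⟨_, ⟨w, hw, rfl⟩, hwβ⟩ := exists_lt_of_csInf_lt
    ⟨_, mem_image_of_mem (fun z : ℂ => φ z - s * log ‖z‖)
      (show (1 : ℂ) ∈ ({0}ᶜ : Set ℂ) by simp)⟩
    (lt_add_of_pos_right (legendreHeight φ s) (half_pos hη))
  have hw : w ≠ 0 := hw
  have hw0 := norm_pos_iff.2 hw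
  have hβ : legendreHeight φ s ≤ φ 1 := by
    simpa using mul_log_add_legendreHeight_le hφ0 hφg hs0 hs1 one_ne_zero
  have hwR : ‖w‖ < R := by
    by_contra! h
    have h1 := hR w h
    have h2 := log_nonneg (hR1.trans h)
    simp only at hwβ
    nlinarith
  set c : ℂ := ((‖w‖ + ρ' / 2 : ℝ) : ℂ) with hc
  have hcn : ‖c‖ = ‖w‖ + ρ' / 2 := by
    rw [hc, Complex.norm_real, norm_of_nonneg (by positivity)]
  have hvol : volume.real (ball (0 : ℂ) (ρ' / 2)) = volume.real (ball c (ρ' / 2)) := by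
    simp [Measure.real]
  have hball : ∀ z ∈ ball c (ρ' / 2), exp (-2 * n * (legendreHeight φ s + η)) ≤
      ‖z‖ ^ (2 * j) * exp (-2 * n * φ z) := by
    intro z hz
    rw [mem_ball_iff_norm] at hz
    have h1 := norm_sub_norm_le c z
    rw [norm_sub_rev] at h1
    have h2 := norm_sub_norm_le z c
    have hzw : ‖w‖ ≤ ‖z‖ := by linarith
    have hz0 : z ≠ 0 := norm_pos_iff.1 (hw0.trans_le hzw)
    have h3 : ‖z - (‖w‖ : ℂ)‖ < ρ' := by
      have e : z - (‖w‖ : ℂ) = (z - c) + ((ρ' / 2 : ℝ) : ℂ) := by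
        rw [hc]
        push_cast
        ring
      rw [e]
      refine (norm_add_le _ _).trans_lt ?_
      rw [Complex.norm_real, norm_of_nonneg (by positivity)]
      linarith
    have h4 := hρφ z (by
        rw [mem_closedBall_zero_iff]
        linarith [min_le_right ρ 1]) (‖w‖ : ℂ) (by
        rw [mem_closedBall_zero_iff, Complex.norm_real, norm_norm]
        linarith) (by
        rw [dist_eq_norm]
        exact h3.trans_le (min_le_left _ _))
    rw [← hφr w, Real.dist_eq] at h4
    have h5 := (abs_lt.1 h4).2
    have h6 : s * log ‖w‖ ≤ s * log ‖z‖ := by gcongr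
    rw [weight_eq_exp hn hz0, ← hs]
    refine exp_le_exp.2 ?_
    have h7 : (n : ℝ) * (-(legendreHeight φ s + η)) ≤ n * (s * log ‖z‖ - φ z) :=
      mul_le_mul_of_nonneg_left (by simp only at hwβ; linarith) (Nat.cast_nonneg n)
    nlinarith
  rw [hvol]
  calc volume.real (ball c (ρ' / 2)) * exp (-2 * n * (legendreHeight φ s + η))
      = ∫ _ in ball c (ρ' / 2), exp (-2 * n * (legendreHeight φ s + η)) := by
        rw [setIntegral_const, smul_eq_mul]
    _ ≤ ∫ z in ball c (ρ' / 2), ‖z‖ ^ (2 * j) * exp (-2 * n * φ z) :=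
        setIntegral_mono_on (integrableOn_const measure_ball_lt_top.ne) hint.integrableOn
          measurableSet_ball hball
    _ ≤ _ := setIntegral_le_integral hint (Eventually.of_forall fun z => by positivity)

/-- Uniformly in `j ≤ n`, `c_j^n` equals `exp (n β (j / n))` up to a factor `exp (o(n))`, where `β` is
`legendreHeight φ`. -/
theorem eventually_normConst_bounds (hφc : Continuous φ) (hφ0 : ∀ z, 0 ≤ φ z)
    (hφr : ∀ z : ℂ, φ z = φ (‖z‖ : ℂ))
    (hφg : ∃ δ : ℝ, 0 < δ ∧ ∀ᶠ z in Bornology.cobounded ℂ, (1 + δ) * log ‖z‖ ≤ φ z)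
    {η : ℝ} (hη : 0 < η) :
    ∀ᶠ n : ℕ in atTop, ∀ j ≤ n,
      exp (n * (legendreHeight φ (j / n) - η)) ≤ normConst φ n j ∧
      normConst φ n j ≤ exp (n * (legendreHeight φ (j / n) + η)) := by
  obtain ⟨K, hK⟩ := exists_integral_weight_le hφc hφ0 hφg
  obtain ⟨k, hk, hkl⟩ := exists_le_integral_weight hφc hφ0 hφr hφg (half_pos hη)
  have ht : Tendsto (fun n : ℕ => exp (η * n)) atTop atTop :=
    tendsto_exp_atTop.comp (tendsto_natCast_atTop_atTop.const_mul_atTop hη)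
  have hexp : ∀ x : ℝ, exp (-2 * x) ^ (-(1 / 2) : ℝ) = exp x := fun x => by
    rw [← exp_mul]
    congr 1
    ring
  filter_upwards [hK, eventually_ne_atTop 0, ht.eventually_ge_atTop K,
    ht.eventually_ge_atTop k⁻¹] with n hn hn0 hnK hnk j hj
  obtain ⟨hint, hup⟩ := hn j hj
  have hlow := hkl n j hn0 hj hint
  set s : ℝ := j / n with hs
  set I : ℝ := ∫ z : ℂ, ‖z‖ ^ (2 * j) * exp (-2 * n * φ z) with hI
  have hup' : I ≤ exp (-2 * (n * (legendreHeight φ s - η))) := by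
    refine hup.trans ?_
    calc K * exp (-2 * n * legendreHeight φ s)
        ≤ exp (2 * η * n) * exp (-2 * n * legendreHeight φ s) := by
          gcongr
          refine hnK.trans (exp_le_exp.2 ?_)
          have : 0 ≤ η * n := by positivity
          linarith
      _ = _ := by rw [← exp_add]; congr 1; ring
  have hlow' : exp (-2 * (n * (legendreHeight φ s + η))) ≤ I := by
    refine le_trans ?_ hlow
    have h1 : exp (-(η * n)) ≤ k := by
      rw [exp_neg]
      exact inv_le_of_inv_le₀ hk hnk
    calc exp (-2 * (n * (legendreHeight φ s + η)))
        = exp (-(η * n)) * exp (-2 * n * (legendreHeight φ s + η / 2)) := by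
          rw [← exp_add]; congr 1; ring
      _ ≤ _ := by gcongr
  have hIpos : 0 < I := (exp_pos _).trans_le hlow'
  have hnc : normConst φ n j = I ^ (-(1 / 2) : ℝ) := rfl
  rw [hnc]
  constructor
  · rw [← hexp]
    exact rpow_le_rpow_of_nonpos hIpos hup' (by norm_num)
  · rw [← hexp]
    exact rpow_le_rpow_of_nonpos (exp_pos _) hlow' (by norm_num)

theorem exp_mul_pow_eq {n j : ℕ} (hn : n ≠ 0) {z : ℂ} (hz : z ≠ 0) (b : ℝ) :
    exp (n * b) * ‖z‖ ^ j = exp (n * ((j / n : ℝ) * log ‖z‖ + b)) := by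
  have hn' : (n : ℝ) ≠ 0 := by exact_mod_cast hn
  have h : ‖z‖ ^ j = exp (j * log ‖z‖) := by
    rw [exp_nat_mul, exp_log (norm_pos_iff.2 hz)]
  rw [h, ← exp_add]
  congr 1
  field_simp
  ring

/-- No term of the polynomial exceeds `exp (n (U_φ + η))`. -/
theorem eventually_normConst_mul_pow_le (hφc : Continuous φ) (hφ0 : ∀ z, 0 ≤ φ z)
    (hφr : ∀ z : ℂ, φ z = φ (‖z‖ : ℂ))
    (hφg : ∃ δ : ℝ, 0 < δ ∧ ∀ᶠ z in Bornology.cobounded ℂ, (1 + δ) * log ‖z‖ ≤ φ z)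
    {η : ℝ} (hη : 0 < η) :
    ∀ᶠ n : ℕ in atTop, ∀ j ≤ n, ∀ z : ℂ,
      normConst φ n j * ‖z‖ ^ j ≤ exp (n * (equilibriumPotential φ z + η)) := by
  have hVc := continuous_equilibriumPotential hφc hφ0 hφr
  filter_upwards [eventually_normConst_bounds hφc hφ0 hφr hφg hη, eventually_ne_atTop 0]
    with n hn hn0 j hj
  obtain ⟨hs0, hs1⟩ := natCast_div_mem hj
  have hne : ∀ z : ℂ, z ≠ 0 →
      normConst φ n j * ‖z‖ ^ j ≤ exp (n * (equilibriumPotential φ z + η)) := by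
    intro z hz
    refine (mul_le_mul_of_nonneg_right (hn j hj).2 (by positivity)).trans ?_
    rw [exp_mul_pow_eq hn0 hz]
    refine exp_le_exp.2 (mul_le_mul_of_nonneg_left ?_ (Nat.cast_nonneg n))
    have := log_le_equilibriumPotential hφc hφ0 hs0 hs1
      (fun z hz => mul_log_add_legendreHeight_le hφ0 hφg hs0 hs1 hz) hz
    linarith
  intro z
  have hcl : closure ({0}ᶜ : Set ℂ) ⊆
      {z | normConst φ n j * ‖z‖ ^ j ≤ exp (n * (equilibriumPotential φ z + η))} :=
    closure_minimal hne (isClosed_le (by fun_prop) (by fun_prop))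
  exact hcl (by rw [closure_compl_singleton]; trivial)

/-- At a given point some term of the polynomial reaches `exp (n (U_φ - η))`. -/
theorem eventually_exists_le_normConst_mul_pow (hφc : Continuous φ) (hφ0 : ∀ z, 0 ≤ φ z)
    (hφr : ∀ z : ℂ, φ z = φ (‖z‖ : ℂ))
    (hφg : ∃ δ : ℝ, 0 < δ ∧ ∀ᶠ z in Bornology.cobounded ℂ, (1 + δ) * log ‖z‖ ≤ φ z)
    {η : ℝ} (hη : 0 < η) (z₀ : ℂ) :
    ∀ᶠ n : ℕ in atTop, ∃ j ≤ n,
      exp (n * (equilibriumPotential φ z₀ - η)) ≤ normConst φ n j * ‖z₀‖ ^ j := by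
  set x := equilibriumPotential φ z₀ with hx
  have hx0 : 0 ≤ x := equilibriumPotential_nonneg hφ0 z₀
  have hbd := eventually_normConst_bounds hφc hφ0 hφr hφg (half_pos hη)
  have hzero : x ≤ legendreHeight φ 0 → ∀ᶠ n : ℕ in atTop, ∃ j ≤ n,
      exp (n * (x - η)) ≤ normConst φ n j * ‖z₀‖ ^ j := by
    intro h
    filter_upwards [hbd] with n hn
    refine ⟨0, n.zero_le, ?_⟩
    have h1 := (hn 0 n.zero_le).1
    rw [Nat.cast_zero, zero_div] at h1
    rw [pow_zero, mul_one]
    refine le_trans (exp_le_exp.2 ?_) h1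
    gcongr
    linarith
  rcases eq_or_ne z₀ 0 with rfl | hz₀
  · refine hzero (le_legendreHeight fun z _ => ?_)
    rw [zero_mul, zero_add]
    exact equilibriumPotential_le_of_norm_le hφ0 hφr (by simp)
  obtain ⟨s, hs0, hs1, hs⟩ := exists_supporting_line hφ0 hφr hz₀
  rw [← hx] at hs
  rcases hs0.eq_or_lt with rfl | hspos
  · refine hzero (le_legendreHeight fun z hz => ?_)
    simpa using hs z hz
  -- the degree `⌊s n⌋` realizes the slope `s` up to `1 / n`
  have ht : Tendsto (fun n : ℕ => s * η / 2 * (n : ℝ)) atTop atTop :=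
    tendsto_natCast_atTop_atTop.const_mul_atTop (by positivity)
  filter_upwards [hbd, eventually_ne_atTop 0, ht.eventually_ge_atTop x] with n hn hn0 hnx
  have hn' : 0 < (n : ℝ) := by exact_mod_cast Nat.pos_of_ne_zero hn0
  set j := ⌊s * n⌋₊ with hj
  have hjle : (j : ℝ) ≤ s * n := Nat.floor_le (by positivity)
  have hjn : j ≤ n := by
    have : (j : ℝ) ≤ n := hjle.trans (by nlinarith)
    exact_mod_cast this
  refine ⟨j, hjn, ?_⟩
  refine le_trans ?_ (mul_le_mul_of_nonneg_right (hn j hjn).1 (by positivity))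
  rw [exp_mul_pow_eq hn0 hz₀]
  refine exp_le_exp.2 (mul_le_mul_of_nonneg_left ?_ hn'.le)
  set q : ℝ := j / (s * n) with hq
  have hq0 : 0 ≤ q := by positivity
  have hq1 : q ≤ 1 := div_le_one_of_le₀ hjle (by positivity)
  have hqs : q * s = j / n := by
    rw [hq]
    field_simp
  have hβ : q * (x - s * log ‖z₀‖) ≤ legendreHeight φ (j / n) := by
    refine le_legendreHeight fun z hz => ?_
    rw [← hqs]
    have h1 := mul_le_mul_of_nonneg_left (hs z hz) hq0
    have h2 := mul_le_mul_of_nonneg_right hq1 (hφ0 z)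
    linarith
  have hq2 : 1 - q ≤ 1 / (s * n) := by
    have h1 : s * n - j ≤ 1 := by linarith [Nat.lt_floor_add_one (s * (n : ℝ))]
    rw [hq, sub_le_iff_le_add, ← add_div, le_div_iff₀ (by positivity)]
    linarith
  have h3 : (1 - q) * x ≤ η / 2 := by
    have h4 : 1 / (s * n) * x ≤ η / 2 := by
      rw [one_div, inv_mul_le_iff₀ (by positivity)]
      linarith
    exact (mul_le_mul_of_nonneg_right hq2 hx0).trans h4
  rw [← hqs] at hβ ⊢
  linarith

end NormalizingConstants

/-! ### Gaussian estimates -/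

section GaussianEstimates

open MeasureTheory Filter Real Metric Set RandomPoly ProbabilityTheory

variable {φ : ℂ → ℝ}

theorem gaussianReal_le_volume : gaussianReal 0 1 ≤ (volume : Measure ℝ) := by
  rw [gaussianReal_of_var_ne_zero _ one_ne_zero]
  refine Measure.le_iff.2 fun s hs => ?_
  rw [withDensity_apply _ hs, ← setLIntegral_one]
  refine lintegral_mono fun x => ?_
  rw [gaussianPDF, ENNReal.ofReal_le_one, gaussianPDFReal]
  have h1 : (√(2 * π * (1 : NNReal)))⁻¹ ≤ 1 := by
    refine inv_le_one_of_one_le₀ (one_le_sqrt.2 ?_)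
    simp only [NNReal.coe_one]
    linarith [pi_gt_three]
  have h2 : exp (-(x - 0) ^ 2 / (2 * (1 : NNReal))) ≤ 1 := by
    rw [exp_le_one_iff, NNReal.coe_one]
    nlinarith [sq_nonneg (x - 0)]
  exact mul_le_one₀ h1 (exp_pos _).le h2

instance (n : ℕ) : IsProbabilityMeasure (gaussianProb n) := by
  unfold gaussianProb
  infer_instance

theorem gaussianProb_abs_gt_le {n : ℕ} (j : Fin (n + 1)) {T : ℝ} (hT : 0 < T) :
    gaussianProb n {a | T < |a j|} ≤ ENNReal.ofReal (1 / T ^ 2) := by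
  have hmp : MeasurePreserving (Function.eval j) (gaussianProb n) (gaussianReal 0 1) :=
    measurePreserving_eval (fun _ : Fin (n + 1) => gaussianReal 0 1) j
  have hmeas : MeasurableSet {x : ℝ | T ≤ |x|} :=
    (isClosed_le continuous_const continuous_abs).measurableSet
  have h := meas_ge_le_variance_div_sq (memLp_id_gaussianReal (μ := 0) (v := 1) 2) hT
  simp only [id_eq, integral_id_gaussianReal, sub_zero, variance_id_gaussianReal,
    NNReal.coe_one] at h
  rw [← hmp.measure_preimage hmeas.nullMeasurableSet] at h
  exact (measure_mono fun a ha => (le_of_lt ha : T ≤ |a j|)).trans h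

/-- Anti-concentration: a Gaussian linear form is rarely much smaller than one of its
coefficients. -/
theorem gaussianProb_norm_sum_lt_le {n : ℕ} (w : Fin (n + 1) → ℂ) (j : Fin (n + 1)) (hw : w j ≠ 0)
    {t : ℝ} :
    gaussianProb n {a | ‖∑ k, (a k : ℂ) * w k‖ < t * ‖w j‖} ≤ ENNReal.ofReal (2 * t) := by
  set T : Set (ℝ × (Fin n → ℝ)) :=
    {p | ‖(p.1 : ℂ) * w j + ∑ k, (p.2 k : ℂ) * w (j.succAbove k)‖ < t * ‖w j‖} with hT
  have hTm : MeasurableSet T := by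
    refine (isOpen_lt ?_ continuous_const).measurableSet
    fun_prop
  have hmp := measurePreserving_piFinSuccAbove (fun _ : Fin (n + 1) => gaussianReal 0 1) j
  have hS : {a : Fin (n + 1) → ℝ | ‖∑ k, (a k : ℂ) * w k‖ < t * ‖w j‖} =
      MeasurableEquiv.piFinSuccAbove (fun _ => ℝ) j ⁻¹' T := by
    ext a
    simp only [mem_preimage, hT, mem_ofPred_eq]
    rw [Fin.sum_univ_succAbove _ j]
    rfl
  unfold gaussianProb
  rw [hS, hmp.measure_preimage hTm.nullMeasurableSet, Measure.prod_apply_symm hTm]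
  have hfib : ∀ y : Fin n → ℝ,
      gaussianReal 0 1 ((fun x => (x, y)) ⁻¹' T) ≤ ENNReal.ofReal (2 * t) := by
    intro y
    refine (gaussianReal_le_volume _).trans ?_
    set b : ℂ := (∑ k, (y k : ℂ) * w (j.succAbove k)) / w j with hb
    have hsub : (fun x => (x, y)) ⁻¹' T ⊆ ball (-b.re) t := by
      intro x hx
      have hx' : ‖(x : ℂ) * w j + ∑ k, (y k : ℂ) * w (j.succAbove k)‖ < t * ‖w j‖ := hx
      have e : (x : ℂ) * w j + ∑ k, (y k : ℂ) * w (j.succAbove k) = (x + b) * w j := by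
        rw [hb, add_mul, div_mul_cancel₀ _ hw]
      rw [e, norm_mul] at hx'
      have h1 := lt_of_mul_lt_mul_right hx' (norm_nonneg _)
      rw [mem_ball, Real.dist_eq, sub_neg_eq_add]
      refine lt_of_le_of_lt ?_ h1
      simpa using Complex.abs_re_le_norm (x + b)
    exact (measure_mono hsub).trans (by rw [Real.volume_ball])
  calc _ ≤ ∫⁻ _ : Fin n → ℝ, ENNReal.ofReal (2 * t)
        ∂(Measure.pi fun _ => gaussianReal 0 1) := lintegral_mono hfib
    _ = _ := by simp

theorem eval_randPoly (n : ℕ) (a : Fin (n + 1) → ℝ) (z : ℂ) :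
    (randPoly φ n a).eval z = ∑ k, (a k : ℂ) * ((normConst φ n k : ℂ) * z ^ (k : ℕ)) := by
  simp [randPoly, Polynomial.eval_finsetSum, mul_assoc]

theorem normConst_nonneg (n j : ℕ) : 0 ≤ normConst φ n j :=
  rpow_nonneg (integral_nonneg fun z => by positivity) _

/-- With overwhelming probability `(1 / n) log |f_n|` lies below `U_φ + η` everywhere and above
`U_φ - η` at finitely many prescribed points. -/
theorem eventually_gaussianProb_compl_le (hφc : Continuous φ) (hφ0 : ∀ z, 0 ≤ φ z)
    (hφr : ∀ z : ℂ, φ z = φ (‖z‖ : ℂ))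
    (hφg : ∃ δ : ℝ, 0 < δ ∧ ∀ᶠ z in Bornology.cobounded ℂ, (1 + δ) * log ‖z‖ ≤ φ z)
    {η : ℝ} (hη : 0 < η) (Z : Finset ℂ) :
    ∀ᶠ n : ℕ in atTop, gaussianProb n {a |
      ¬((∀ z, ‖(randPoly φ n a).eval z‖ ≤ exp (n * (equilibriumPotential φ z + η))) ∧
        ∀ z ∈ Z, exp (n * (equilibriumPotential φ z - η)) ≤ ‖(randPoly φ n a).eval z‖)} ≤
      ENNReal.ofReal (exp (-(η / 4) * n)) := by
  have hη4 : 0 < η / 4 := by positivity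
  have hlow : ∀ᶠ n : ℕ in atTop, ∀ z ∈ Z, ∃ j ≤ n,
      exp (n * (equilibriumPotential φ z - η / 2)) ≤ normConst φ n j * ‖z‖ ^ j :=
    (Finset.eventually_all Z).2 fun z _ =>
      eventually_exists_le_normConst_mul_pow hφc hφ0 hφr hφg (half_pos hη) z
  have hgrow : ∀ᶠ n : ℕ in atTop, (n : ℝ) + 1 + 2 * Z.card ≤ exp (η / 4 * n) := by
    have h1 : Tendsto (fun x : ℝ => exp (η / 4 * x) / x ^ 1) atTop atTop :=
      tendsto_exp_mul_div_rpow_atTop 1 (η / 4) hη4 |>.congr fun x => by simp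
    have h2 := h1.comp tendsto_natCast_atTop_atTop
    filter_upwards [h2.eventually_ge_atTop (2 + 2 * Z.card : ℝ), eventually_ge_atTop 1] with n hn hn1
    have hn1' : (1 : ℝ) ≤ n := by exact_mod_cast hn1
    simp only [Function.comp_apply, pow_one] at hn
    rw [le_div_iff₀ (by linarith)] at hn
    have : (0 : ℝ) ≤ Z.card := Nat.cast_nonneg _
    nlinarith
  filter_upwards [hlow, hgrow, eventually_normConst_mul_pow_le hφc hφ0 hφr hφg hη4]
    with n hlow hgrow hup
  have hZ0 : (0 : ℝ) ≤ Z.card := Nat.cast_nonneg _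
  -- coefficients are cut off at `T`, and `t = T ^ (-2)` bounds the probability of each exception
  set T : ℝ := exp (η / 4 * n) with hT
  have hT0 : 0 < T := exp_pos _
  set t : ℝ := exp (-(η / 2) * n) with ht
  have htT : 1 / T ^ 2 = t := by
    rw [hT, ht, ← exp_nat_mul, one_div, ← exp_neg]
    congr 1
    push_cast
    ring
  have hcover : {a |
      ¬((∀ z, ‖(randPoly φ n a).eval z‖ ≤ exp (n * (equilibriumPotential φ z + η))) ∧
        ∀ z ∈ Z, exp (n * (equilibriumPotential φ z - η)) ≤ ‖(randPoly φ n a).eval z‖)} ⊆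
      (⋃ j ∈ (Finset.univ : Finset (Fin (n + 1))), {a | T < |a j|}) ∪
      ⋃ z ∈ Z, {a | ‖(randPoly φ n a).eval z‖ < exp (n * (equilibriumPotential φ z - η))} := by
    intro a ha
    by_contra hcon
    simp only [mem_union, mem_iUnion, mem_ofPred_eq, not_or, not_exists, not_lt,
      Finset.mem_univ, exists_prop, true_and, not_and] at hcon ha
    obtain ⟨hc1, hc2⟩ := hcon
    refine absurd (ha fun z => ?_) (fun h => ?_)
    · rw [eval_randPoly]
      calc ‖∑ k, (a k : ℂ) * ((normConst φ n k : ℂ) * z ^ (k : ℕ))‖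
          ≤ ∑ k : Fin (n + 1), T * exp (n * (equilibriumPotential φ z + η / 4)) := by
            refine norm_sum_le_of_le _ fun k _ => ?_
            rw [norm_mul, norm_mul, norm_pow, Complex.norm_real, Complex.norm_real,
              Real.norm_eq_abs, Real.norm_of_nonneg (normConst_nonneg n k)]
            exact mul_le_mul (hc1 k) (hup k (Nat.lt_succ_iff.1 k.2) z)
              (mul_nonneg (normConst_nonneg n k) (by positivity)) hT0.le
        _ = (n + 1) * (T * exp (n * (equilibriumPotential φ z + η / 4))) := by
            simp
        _ ≤ T * (T * exp (n * (equilibriumPotential φ z + η / 4))) := by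
            gcongr
            linarith
        _ ≤ exp (n * (equilibriumPotential φ z + η)) := by
            rw [hT, ← exp_add, ← exp_add]
            refine exp_le_exp.2 ?_
            have : 0 ≤ n * η := by positivity
            linarith
    · exact h hc2
  refine (measure_mono hcover).trans ((measure_union_le _ _).trans ?_)
  have hA : gaussianProb n (⋃ j ∈ (Finset.univ : Finset (Fin (n + 1))), {a | T < |a j|}) ≤
      ENNReal.ofReal ((n + 1) * t) := by
    refine (measure_biUnion_finset_le _ _).trans ?_
    refine (Finset.sum_le_sum fun j _ => gaussianProb_abs_gt_le j hT0).trans (le_of_eq ?_)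
    rw [htT, Finset.sum_const, Finset.card_univ, Fintype.card_fin, nsmul_eq_mul,
      ENNReal.ofReal_mul (by positivity), ← Nat.cast_succ, ENNReal.ofReal_natCast]
  have hB : gaussianProb n (⋃ z ∈ Z,
      {a | ‖(randPoly φ n a).eval z‖ < exp (n * (equilibriumPotential φ z - η))}) ≤
      ENNReal.ofReal (Z.card * (2 * t)) := by
    refine (measure_biUnion_finset_le _ _).trans ?_
    have hone : ∀ z ∈ Z, gaussianProb n
        {a | ‖(randPoly φ n a).eval z‖ < exp (n * (equilibriumPotential φ z - η))} ≤
        ENNReal.ofReal (2 * t) := by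
      intro z hz
      obtain ⟨j, hj, hle⟩ := hlow z hz
      have hnorm : ‖(normConst φ n j : ℂ) * z ^ j‖ = normConst φ n j * ‖z‖ ^ j := by
        rw [norm_mul, norm_pow, Complex.norm_real, Real.norm_of_nonneg (normConst_nonneg n j)]
      have hne : (normConst φ n j : ℂ) * z ^ j ≠ 0 := by
        rw [← norm_pos_iff, hnorm]
        exact (exp_pos _).trans_le hle
      refine (measure_mono fun a ha => ?_).trans (gaussianProb_norm_sum_lt_le
        (fun k : Fin (n + 1) => (normConst φ n k : ℂ) * z ^ (k : ℕ)) ⟨j, Nat.lt_succ_iff.2 hj⟩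
        hne (t := t))
      simp only [mem_ofPred_eq, eval_randPoly] at ha ⊢
      refine ha.trans_le ?_
      rw [hnorm]
      calc exp (n * (equilibriumPotential φ z - η))
          = t * exp (n * (equilibriumPotential φ z - η / 2)) := by
            rw [ht, ← exp_add]; congr 1; ring
        _ ≤ _ := by gcongr
    refine (Finset.sum_le_sum hone).trans (le_of_eq ?_)
    rw [Finset.sum_const, nsmul_eq_mul, ENNReal.ofReal_mul hZ0, ENNReal.ofReal_natCast]
  have ht0 : 0 ≤ t := (exp_pos _).le
  refine (add_le_add hA hB).trans ?_
  rw [← ENNReal.ofReal_add (mul_nonneg (by positivity) ht0)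
    (mul_nonneg hZ0 (mul_nonneg two_pos.le ht0))]
  refine ENNReal.ofReal_le_ofReal ?_
  calc (n + 1) * t + Z.card * (2 * t) = (n + 1 + 2 * Z.card) * t := by ring
    _ ≤ T * t := by gcongr
    _ = exp (-(η / 4) * n) := by
      rw [hT, ht, ← exp_add]; congr 1; ring

end GaussianEstimates

/-! ### Logarithmic potentials of polynomials -/

section LogPotential

open MeasureTheory Filter Real Metric Set

/-- The logarithmic potential `∑ log |z - a|` of a finite multiset of points (with the value of
`Real.log 0 = 0` for the term of a point at itself). -/
noncomputable def logPotential (s : Multiset ℂ) (z : ℂ) : ℝ :=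
  (s.map fun a => log ‖z - a‖).sum

theorem logPotential_cons (a : ℂ) (s : Multiset ℂ) (z : ℂ) :
    logPotential (a ::ₘ s) z = log ‖z - a‖ + logPotential s z := by
  simp [logPotential]

theorem locallyIntegrable_logPotential (s : Multiset ℂ) : LocallyIntegrable (logPotential s) := by
  induction s using Multiset.induction with
  | empty =>
    have : logPotential 0 = fun _ => 0 := by ext z; simp [logPotential]
    rw [this]
    exact locallyIntegrable_const 0
  | cons a s ih =>
    have : logPotential (a ::ₘ s) = (fun z => log ‖z - a‖) + logPotential s := by
      ext z
      exact logPotential_cons a s z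
    rw [this]
    exact (locallyIntegrable_log_norm_sub a).add ih

theorem log_prod_norm_sub {s : Multiset ℂ} {z : ℂ} (hz : z ∉ s) :
    0 < (s.map fun a => ‖z - a‖).prod ∧ log (s.map fun a => ‖z - a‖).prod = logPotential s z := by
  induction s using Multiset.induction with
  | empty => simp [logPotential]
  | cons a s ih =>
    rw [Multiset.mem_cons, not_or] at hz
    obtain ⟨h1, h2⟩ := ih hz.2
    have h3 : 0 < ‖z - a‖ := norm_pos_iff.2 (sub_ne_zero.2 hz.1)
    rw [Multiset.map_cons, Multiset.prod_cons, logPotential_cons]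
    exact ⟨mul_pos h3 h1, by rw [log_mul h3.ne' h1.ne', h2]⟩

theorem mul_logPotential_le_setIntegral_ball (s : Multiset ℂ) {c : ℂ} (hc : c ∉ s) (ρ : ℝ) :
    volume.real (ball c ρ) * logPotential s c ≤ ∫ z in ball c ρ, logPotential s z := by
  induction s using Multiset.induction with
  | empty => simp [logPotential]
  | cons a s ih =>
    rw [Multiset.mem_cons, not_or] at hc
    have hi : ∀ {F : ℂ → ℝ}, LocallyIntegrable F → IntegrableOn F (ball c ρ) := fun hF =>
      (hF.integrableOn_isCompact (isCompact_closedBall c ρ)).mono_set ball_subset_closedBall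
    have h1 := mul_le_setIntegral_ball (F := fun z => log ‖z - a‖) (by fun_prop)
      (hi (locallyIntegrable_log_norm_sub a)) fun r hr => log_le_circleAverage_log hc.1 hr
    simp only [logPotential_cons]
    rw [integral_add (hi (locallyIntegrable_log_norm_sub a)) (hi (locallyIntegrable_logPotential s))]
    linarith [ih hc.2]

theorem continuous_laplacian {ψ : ℂ → ℝ} (hψ : ContDiff ℝ 2 ψ) :
    Continuous (Laplacian.laplacian ψ) := by
  rw [InnerProductSpace.laplacian_eq_iteratedFDeriv_complexPlane]
  have h : Continuous (iteratedFDeriv ℝ 2 ψ) := hψ.continuous_iteratedFDeriv le_rfl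
  fun_prop

theorem laplacian_eq_zero_of_notMem_tsupport {ψ : ℂ → ℝ} {z : ℂ} (hz : z ∉ tsupport ψ) :
    Laplacian.laplacian ψ z = 0 := by
  have h : ψ =ᶠ[𝓝 z] fun _ => 0 := notMem_tsupport_iff_eventuallyEq.1 hz
  have := (InnerProductSpace.laplacian_congr_nhds h).eq_of_nhds
  rw [this]
  simp

theorem hasCompactSupport_laplacian {ψ : ℂ → ℝ} (hψc : HasCompactSupport ψ) :
    HasCompactSupport (Laplacian.laplacian ψ) :=
  HasCompactSupport.intro hψc fun _ hz => laplacian_eq_zero_of_notMem_tsupport hz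

theorem integrable_mul_laplacian {F ψ : ℂ → ℝ} (hF : LocallyIntegrable F) (hψ : ContDiff ℝ 2 ψ)
    (hψc : HasCompactSupport ψ) : Integrable fun z => F z * Laplacian.laplacian ψ z := by
  simpa [mul_comm, smul_eq_mul] using hF.integrable_smul_left_of_hasCompactSupport
    (continuous_laplacian hψ) (hasCompactSupport_laplacian hψc)

theorem integral_logPotential_mul_laplacian (s : Multiset ℂ) {ψ : ℂ → ℝ} (hψ : ContDiff ℝ 2 ψ)
    (hψc : HasCompactSupport ψ) :
    ∫ z, logPotential s z * Laplacian.laplacian ψ z = 2 * π * (s.map ψ).sum := by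
  induction s using Multiset.induction with
  | empty => simp [logPotential]
  | cons a s ih =>
    simp only [logPotential_cons, add_mul, Multiset.map_cons, Multiset.sum_cons]
    rw [integral_add (integrable_mul_laplacian (locallyIntegrable_log_norm_sub a) hψ hψc)
      (integrable_mul_laplacian (locallyIntegrable_logPotential s) hψ hψc), ih,
      integral_log_norm_sub_mul_laplacian hψ hψc]
    ring

/-- The potential `(1 / n) log |p|` of a polynomial, written through the leading coefficient and the
roots. The two expressions agree where `p` does not vanish; at a root the term `log 0 = 0` is
dropped, which is harmless as the roots are a null set. -/
noncomputable def polyPotential (n : ℕ) (p : Polynomial ℂ) (z : ℂ) : ℝ :=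
  (log ‖p.leadingCoeff‖ + logPotential p.roots z) / n

theorem norm_eval_prod_X_sub_C (s : Multiset ℂ) (z : ℂ) :
    ‖((s.map fun a => Polynomial.X - Polynomial.C a).prod).eval z‖ =
      (s.map fun a => ‖z - a‖).prod := by
  induction s using Multiset.induction with
  | empty => simp
  | cons a s ih => simp [Polynomial.eval_mul, ih]

theorem polyPotential_eq {n : ℕ} {p : Polynomial ℂ} {z : ℂ} (hz : p.eval z ≠ 0) :
    polyPotential n p z = log ‖p.eval z‖ / n := by
  have hp : p ≠ 0 := by
    rintro rfl
    simp at hz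
  have hz' : z ∉ p.roots := fun h => hz (Polynomial.isRoot_of_mem_roots h)
  obtain ⟨h1, h2⟩ := log_prod_norm_sub hz'
  have h3 : ‖p.eval z‖ = ‖p.leadingCoeff‖ * (p.roots.map fun a => ‖z - a‖).prod := by
    conv_lhs => rw [(IsAlgClosed.splits p).eq_prod_roots]
    rw [Polynomial.eval_mul, Polynomial.eval_C, norm_mul, norm_eval_prod_X_sub_C]
  rw [polyPotential, h3, log_mul (norm_ne_zero_iff.2 (Polynomial.leadingCoeff_ne_zero.2 hp)) h1.ne',
    h2]

theorem locallyIntegrable_polyPotential (n : ℕ) (p : Polynomial ℂ) :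
    LocallyIntegrable (polyPotential n p) := by
  have h := ((locallyIntegrable_const (log ‖p.leadingCoeff‖)).add
    (locallyIntegrable_logPotential p.roots)).smul ((n : ℝ)⁻¹)
  refine h.congr (Eventually.of_forall fun z => ?_)
  simp only [Pi.smul_apply, Pi.add_apply, smul_eq_mul, polyPotential]
  rw [div_eq_inv_mul]

theorem mul_polyPotential_le_setIntegral_ball (n : ℕ) {p : Polynomial ℂ} {c : ℂ}
    (hc : p.eval c ≠ 0) (ρ : ℝ) :
    volume.real (ball c ρ) * polyPotential n p c ≤ ∫ z in ball c ρ, polyPotential n p z := by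
  have hc' : c ∉ p.roots := fun h => hc (Polynomial.isRoot_of_mem_roots h)
  have hi : ∀ {F : ℂ → ℝ}, LocallyIntegrable F → IntegrableOn F (ball c ρ) := fun hF =>
    (hF.integrableOn_isCompact (isCompact_closedBall c ρ)).mono_set ball_subset_closedBall
  have h := mul_logPotential_le_setIntegral_ball p.roots hc' ρ
  unfold polyPotential
  rw [integral_div, integral_add (hi (locallyIntegrable_const _))
    (hi (locallyIntegrable_logPotential _)), setIntegral_const, smul_eq_mul, ← mul_div_assoc,
    mul_add]
  gcongr

theorem integral_polyPotential_mul_laplacian (n : ℕ) (p : Polynomial ℂ) {ψ : ℂ → ℝ}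
    (hψ : ContDiff ℝ 2 ψ) (hψc : HasCompactSupport ψ) :
    ∫ z, polyPotential n p z * Laplacian.laplacian ψ z = 2 * π * ((p.roots.map ψ).sum / n) := by
  have e : ∀ z, polyPotential n p z * Laplacian.laplacian ψ z =
      (n : ℝ)⁻¹ * (log ‖p.leadingCoeff‖ * Laplacian.laplacian ψ z +
        logPotential p.roots z * Laplacian.laplacian ψ z) := fun z => by
    rw [polyPotential]
    ring
  simp only [e]
  rw [integral_const_mul, integral_add
    (integrable_mul_laplacian (locallyIntegrable_const _) hψ hψc)
    (integrable_mul_laplacian (locallyIntegrable_logPotential _) hψ hψc), integral_const_mul,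
    integral_laplacian_eq_zero hψ hψc, integral_logPotential_mul_laplacian _ hψ hψc]
  ring

end LogPotential

/-! ### From pointwise bounds to convergence of potentials in the mean -/

section MeanConvergence

open MeasureTheory Filter Real Metric Set

theorem setIntegral_abs_sub_ball_le {V u : ℂ → ℝ} (hV : Continuous V) (hu : LocallyIntegrable u)
    {η ρ : ℝ} {c : ℂ} (hη : 0 ≤ η) (hup : ∀ᵐ z, u z ≤ V z + η) (hlow : V c - η ≤ u c)
    (hmean : volume.real (ball c ρ) * u c ≤ ∫ z in ball c ρ, u z)
    (hosc : ∀ z ∈ ball c ρ, V z ≤ V c + η) :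
    ∫ z in ball c ρ, |u z - V z| ≤ 5 * η * volume.real (ball c ρ) := by
  have hi : ∀ {F : ℂ → ℝ}, LocallyIntegrable F → IntegrableOn F (ball c ρ) := fun hF =>
    (hF.integrableOn_isCompact (isCompact_closedBall c ρ)).mono_set ball_subset_closedBall
  have hVi := hi hV.locallyIntegrable
  have hui := hi hu
  have hci : ∀ k : ℝ, IntegrableOn (fun _ => k) (ball c ρ) := fun k =>
    hi (locallyIntegrable_const k)
  have h1 : ∫ z in ball c ρ, |u z - V z| ≤ ∫ z in ball c ρ, ((V c + 3 * η) - u z) := by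
    refine setIntegral_mono_on_ae (hui.sub hVi).abs ((hci _).sub hui) measurableSet_ball ?_
    filter_upwards [hup] with z hz hzb
    have := hosc z hzb
    rw [abs_le]
    constructor <;> linarith
  refine h1.trans ?_
  rw [integral_sub (hci _) hui, setIntegral_const, smul_eq_mul]
  have h2 : volume.real (ball c ρ) * (V c - η) ≤ volume.real (ball c ρ) * u c :=
    mul_le_mul_of_nonneg_left hlow measureReal_nonneg
  have h3 : 0 ≤ η * volume.real (ball c ρ) := mul_nonneg hη measureReal_nonneg
  linarith

/-- A function with the sub-mean value property on discs that is almost bounded above by `V`, and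
almost bounded below by `V` at the points of a fine grid, is close to `V` in the mean. -/
theorem exists_grid {V : ℂ → ℝ} (hV : Continuous V) {R κ : ℝ} (hR : 0 < R) (hκ : 0 < κ) :
    ∃ η : ℝ, 0 < η ∧ ∃ Z : Finset ℂ, ∀ u : ℂ → ℝ, LocallyIntegrable u →
      (∀ᵐ z, u z ≤ V z + η) → (∀ c ∈ Z, V c - η ≤ u c) →
      (∀ c ∈ Z, ∀ ρ : ℝ, volume.real (ball c ρ) * u c ≤ ∫ z in ball c ρ, u z) →
      ∫ z in ball (0 : ℂ) R, |u z - V z| ≤ κ := by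
  -- at most `9 m ^ 2` discs of radius `2 R / m`, each contributing at most `5 η` times its area
  set η : ℝ := κ / (180 * π * R ^ 2) with hη
  have hη0 : 0 < η := by positivity
  obtain ⟨ρ₀, hρ₀, hosc⟩ := Metric.uniformContinuousOn_iff.1
    ((isCompact_closedBall (0 : ℂ) (4 * R)).uniformContinuousOn_of_continuous hV.continuousOn)
    η hη0
  obtain ⟨m, hm⟩ := exists_nat_gt (max 1 (2 * R / ρ₀))
  have hm1 : (1 : ℝ) < m := (le_max_left _ _).trans_lt hm
  have hm0 : (0 : ℝ) < m := by linarith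
  have hmρ : 2 * R / m < ρ₀ := by
    have := (le_max_right _ _).trans_lt hm
    rw [div_lt_iff₀ hρ₀] at this
    rw [div_lt_iff₀ hm0]
    linarith
  set ρ : ℝ := 2 * R / m with hρ
  set P : Finset (ℤ × ℤ) := Finset.Icc (-(m : ℤ)) m ×ˢ Finset.Icc (-(m : ℤ)) m with hP
  set c : ℤ × ℤ → ℂ := fun i => ⟨R / m * i.1, R / m * i.2⟩ with hc
  have hRm : 0 < R / m := by positivity
  have hρ2 : ρ = 2 * (R / m) := by rw [hρ]; ring
  have hcover : ∀ z ∈ ball (0 : ℂ) R, ∃ i ∈ P, z ∈ ball (c i) ρ := by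
    intro z hz
    rw [mem_ball_zero_iff] at hz
    have hfl : ∀ x : ℝ, |x| < R → ⌊x / (R / m)⌋ ∈ Finset.Icc (-(m : ℤ)) m ∧
        |x - R / m * ⌊x / (R / m)⌋| < R / m := by
      intro x hx
      obtain ⟨hx1, hx2⟩ := abs_lt.1 hx
      have hq1 : -(m : ℝ) ≤ x / (R / m) := by
        rw [le_div_iff₀ hRm]
        have : -(m : ℝ) * (R / m) = -R := by field_simp
        linarith
      have hq2 : x / (R / m) < m := by
        rw [div_lt_iff₀ hRm]
        have : (m : ℝ) * (R / m) = R := by field_simp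
        linarith
      refine ⟨Finset.mem_Icc.2 ⟨Int.le_floor.2 (by push_cast; exact hq1), ?_⟩, ?_⟩
      · exact (Int.floor_lt.2 (by exact_mod_cast hq2)).le
      · have e : x - R / m * ⌊x / (R / m)⌋ = R / m * Int.fract (x / (R / m)) := by
          rw [Int.fract, mul_sub, mul_div_cancel₀ _ hRm.ne']
        rw [e, abs_of_nonneg (mul_nonneg hRm.le (Int.fract_nonneg _))]
        exact mul_lt_of_lt_one_right hRm (Int.fract_lt_one _)
    obtain ⟨h1, h2⟩ := hfl z.re ((Complex.abs_re_le_norm z).trans_lt hz)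
    obtain ⟨h3, h4⟩ := hfl z.im ((Complex.abs_im_le_norm z).trans_lt hz)
    refine ⟨(⌊z.re / (R / m)⌋, ⌊z.im / (R / m)⌋), Finset.mk_mem_product h1 h3, ?_⟩
    rw [mem_ball_iff_norm]
    refine (Complex.norm_le_abs_re_add_abs_im _).trans_lt ?_
    rw [hρ2]
    simp only [hc, Complex.sub_re, Complex.sub_im]
    linarith
  have hPc : ∀ i ∈ P, ‖c i‖ ≤ 2 * R := by
    intro i hi
    obtain ⟨h1, h2⟩ := Finset.mem_product.1 hi
    have habs : ∀ k : ℤ, k ∈ Finset.Icc (-(m : ℤ)) m → |R / m * k| ≤ R := by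
      intro k hk
      obtain ⟨hk1, hk2⟩ := Finset.mem_Icc.1 hk
      have hk3 : |(k : ℝ)| ≤ m := abs_le.2 ⟨by exact_mod_cast hk1, by exact_mod_cast hk2⟩
      rw [abs_mul, abs_of_pos hRm, div_mul_eq_mul_div, div_le_iff₀ hm0]
      gcongr
    refine (Complex.norm_le_abs_re_add_abs_im _).trans ?_
    simp only [hc]
    linarith [habs i.1 h1, habs i.2 h2]
  have hvol : ∀ i, volume.real (ball (c i) ρ) = π * ρ ^ 2 := fun i => by
    rw [Measure.real, Complex.volume_ball]
    simp [ENNReal.toReal_ofReal (show 0 ≤ ρ by positivity), mul_comm]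
  have hcard : (P.card : ℝ) ≤ 9 * m ^ 2 := by
    have : P.card = (2 * m + 1) * (2 * m + 1) := by
      rw [hP, Finset.card_product, Int.card_Icc]
      have : ((m : ℤ) + 1 - -(m : ℤ)).toNat = 2 * m + 1 := by omega
      rw [this]
    rw [this]
    push_cast
    nlinarith
  refine ⟨η, hη0, P.image c, fun u hu hup hlow hmean => ?_⟩
  have hint : LocallyIntegrable fun z => |u z - V z| := fun z => by
    obtain ⟨s, hs, hi⟩ := (hu.sub hV.locallyIntegrable) z
    exact ⟨s, hs, hi.norm⟩
  have hi : ∀ (y : ℂ) (r : ℝ), IntegrableOn (fun z => |u z - V z|) (ball y r) := fun y r =>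
    (hint.integrableOn_isCompact (isCompact_closedBall y r)).mono_set ball_subset_closedBall
  have hone : ∀ i ∈ P, ∫ z in ball (c i) ρ, |u z - V z| ≤ 5 * η * (π * ρ ^ 2) := by
    intro i hiP
    have hmem := Finset.mem_image_of_mem c hiP
    rw [← hvol i]
    refine setIntegral_abs_sub_ball_le hV hu hη0.le hup (hlow _ hmem) (hmean _ hmem ρ)
      fun z hz => ?_
    have hρR : ρ < 2 * R := by
      rw [hρ, div_lt_iff₀ hm0]
      nlinarith
    have hci := hPc i hiP
    have hz' := mem_ball_iff_norm.1 hz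
    have h1 := norm_sub_norm_le z (c i)
    have h2 := hosc z (by rw [mem_closedBall_zero_iff]; linarith) (c i)
      (by rw [mem_closedBall_zero_iff]; linarith) ((mem_ball.1 hz).trans hmρ)
    rw [Real.dist_eq] at h2
    linarith [(abs_lt.1 h2).2]
  calc ∫ z in ball (0 : ℂ) R, |u z - V z|
      = ∫ z, (ball (0 : ℂ) R).indicator (fun z => |u z - V z|) z :=
        (integral_indicator measurableSet_ball).symm
    _ ≤ ∫ z, ∑ i ∈ P, (ball (c i) ρ).indicator (fun z => |u z - V z|) z := by
        refine integral_mono ((hi 0 R).integrable_indicator measurableSet_ball)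
          (integrable_finsetSum _ fun i _ => (hi _ _).integrable_indicator measurableSet_ball)
          fun z => ?_
        have hnn : ∀ i ∈ P, 0 ≤ (ball (c i) ρ).indicator (fun z => |u z - V z|) z := fun i _ =>
          indicator_nonneg (fun _ _ => abs_nonneg _) z
        by_cases hz : z ∈ ball (0 : ℂ) R
        · obtain ⟨i, hiP, hzi⟩ := hcover z hz
          have := Finset.single_le_sum hnn hiP
          rw [indicator_of_mem hzi] at this
          simpa only [indicator_of_mem hz] using this
        · simpa only [indicator_of_notMem hz] using Finset.sum_nonneg hnn
    _ = ∑ i ∈ P, ∫ z in ball (c i) ρ, |u z - V z| := by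
        rw [integral_finsetSum _ fun i _ => (hi _ _).integrable_indicator measurableSet_ball]
        exact Finset.sum_congr rfl fun i _ => integral_indicator measurableSet_ball
    _ ≤ ∑ i ∈ P, 5 * η * (π * ρ ^ 2) := Finset.sum_le_sum hone
    _ = P.card * (5 * η * (π * ρ ^ 2)) := by rw [Finset.sum_const, nsmul_eq_mul]
    _ ≤ 9 * m ^ 2 * (5 * η * (π * ρ ^ 2)) := by gcongr
    _ = κ := by
        rw [hη, hρ]
        field_simp
        ring

end MeanConvergence

/-! ### Counting zeros -/

section CountingZeros

open MeasureTheory Filter Real Metric Set RandomPoly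

/-- Smooth functions that sandwich the indicator of a set whose boundary is a null set. -/
theorem exists_smooth_sandwich {ν : Measure ℂ} [IsLocallyFiniteMeasure ν] {U : Set ℂ}
    (hU : Bornology.IsBounded U) (hfr : ν (frontier U) = 0) {ε : ℝ} (hε : 0 < ε) :
    ∃ ψ₁ ψ₂ : ℂ → ℝ, (ContDiff ℝ ∞ ψ₁ ∧ HasCompactSupport ψ₁ ∧ (∀ z, ψ₁ z ≤ 1) ∧
        (∀ z ∉ U, ψ₁ z = 0) ∧ ν.real U - ε ≤ ∫ z, ψ₁ z ∂ν) ∧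
      (ContDiff ℝ ∞ ψ₂ ∧ HasCompactSupport ψ₂ ∧ (∀ z, 0 ≤ ψ₂ z) ∧
        (∀ z ∈ U, ψ₂ z = 1) ∧ ∫ z, ψ₂ z ∂ν ≤ ν.real U + ε) := by
  have hε' : ENNReal.ofReal ε ≠ 0 := by simpa using hε
  have hcc : IsCompact (closure U) := hU.isCompact_closure
  have hclt : ν (closure U) < ⊤ := hcc.measure_lt_top
  have hcl : ν (closure U) ≤ ν (interior U) := by
    rw [closure_eq_interior_union_frontier]
    exact (measure_union_le _ _).trans (by rw [hfr, add_zero])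
  have hUi : ν U ≤ ν (interior U) := (measure_mono subset_closure).trans hcl
  have hUc : ν (closure U) ≤ ν U := hcl.trans (measure_mono interior_subset)
  have hUlt : ν U < ⊤ := (measure_mono subset_closure).trans_lt hclt
  obtain ⟨K, hKU, hK, hKν⟩ := isOpen_interior.measurableSet.exists_isCompact_lt_add
    (μ := ν) (A := interior U) ((measure_mono interior_subset).trans_lt hUlt).ne hε'
  obtain ⟨O, hUO, hO, hOν⟩ := (closure U).exists_isOpen_lt_add (μ := ν) hclt.ne hε'
  have hOlt : ν O < ⊤ := hOν.trans_le le_top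
  obtain ⟨ψ₁, a1, a2, a3, a4, a5, a6⟩ := exists_smooth_cutoff hK isOpen_interior hKU
  obtain ⟨ψ₂, b1, b2, b3, b4, b5, b6⟩ := exists_smooth_cutoff hcc hO hUO
  refine ⟨ψ₁, ψ₂, ⟨a1, a2, a4, fun z hz => a6 z fun h => hz (interior_subset h), ?_⟩,
    ⟨b1, b2, b3, fun z hz => b5 z (subset_closure hz), ?_⟩⟩
  · have h1 : ν.real U ≤ ν.real K + ε := by
      have h2 : ν U ≤ ν K + ENNReal.ofReal ε := hUi.trans hKν.le
      have h3 := ENNReal.toReal_mono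
        (ENNReal.add_ne_top.2 ⟨hK.measure_lt_top.ne, ENNReal.ofReal_ne_top⟩) h2
      rwa [ENNReal.toReal_add hK.measure_lt_top.ne ENNReal.ofReal_ne_top,
        ENNReal.toReal_ofReal hε.le] at h3
    have h2 : ν.real K ≤ ∫ z, ψ₁ z ∂ν := by
      rw [← integral_indicator_one hK.measurableSet]
      refine integral_mono ?_ (a1.continuous.integrable_of_hasCompactSupport a2) fun z => ?_
      · exact (integrable_indicator_iff hK.measurableSet).2
          (integrableOn_const hK.measure_lt_top.ne)
      · exact indicator_le' (fun z hz => (a5 z hz).ge) (fun z _ => a3 z) z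
    linarith
  · have h1 : ν.real O ≤ ν.real U + ε := by
      have h2 : ν O ≤ ν U + ENNReal.ofReal ε := hOν.le.trans (by gcongr)
      have h3 := ENNReal.toReal_mono (ENNReal.add_ne_top.2 ⟨hUlt.ne, ENNReal.ofReal_ne_top⟩) h2
      rwa [ENNReal.toReal_add hUlt.ne ENNReal.ofReal_ne_top, ENNReal.toReal_ofReal hε.le] at h3
    have h2 : ∫ z, ψ₂ z ∂ν ≤ ν.real O := by
      rw [← integral_indicator_one hO.measurableSet]
      refine integral_mono (b1.continuous.integrable_of_hasCompactSupport b2) ?_ fun z => ?_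
      · exact (integrable_indicator_iff hO.measurableSet).2 (integrableOn_const hOlt.ne)
      · by_cases hz : z ∈ O
        · simpa [hz] using b4 z
        · simp [hz, b6 z hz]
    linarith

theorem zeroCount_le_sum {p : Polynomial ℂ} {U : Set ℂ} {ψ : ℂ → ℝ} (h0 : ∀ z, 0 ≤ ψ z)
    (h1 : ∀ z ∈ U, ψ z = 1) : (zeroCount p U : ℝ) ≤ (p.roots.map ψ).sum := by
  classical
  unfold zeroCount
  induction p.roots using Multiset.induction with
  | empty => simp
  | cons a s ih =>
    by_cases ha : a ∈ U
    · simp only [Multiset.countP_cons_of_pos s ha, Multiset.map_cons, Multiset.sum_cons, h1 a ha]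
      push_cast
      linarith
    · simp only [Multiset.countP_cons_of_neg s ha, Multiset.map_cons, Multiset.sum_cons]
      linarith [h0 a]

theorem sum_le_zeroCount {p : Polynomial ℂ} {U : Set ℂ} {ψ : ℂ → ℝ} (h1 : ∀ z, ψ z ≤ 1)
    (h0 : ∀ z ∉ U, ψ z = 0) : (p.roots.map ψ).sum ≤ zeroCount p U := by
  classical
  unfold zeroCount
  induction p.roots using Multiset.induction with
  | empty => simp
  | cons a s ih =>
    by_cases ha : a ∈ U
    · simp only [Multiset.countP_cons_of_pos s ha, Multiset.map_cons, Multiset.sum_cons]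
      push_cast
      linarith [h1 a]
    · simp only [Multiset.countP_cons_of_neg s ha, Multiset.map_cons, Multiset.sum_cons, h0 a ha]
      linarith

/-- Linear statistics of the zeros are controlled by the mean distance of the potentials. -/
theorem abs_sum_roots_sub_le {V : ℂ → ℝ} {ν : Measure ℂ} (hν : IsDistribLaplacian V ν)
    {ψ : ℂ → ℝ} (hψ : ContDiff ℝ ∞ ψ) (hψc : HasCompactSupport ψ) {R B κ : ℝ}
    (hR : tsupport ψ ⊆ ball 0 R) (hB : ∀ z, |Laplacian.laplacian ψ z| ≤ B) {n : ℕ}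
    {p : Polynomial ℂ} (hκ : ∫ z in ball (0 : ℂ) R, |polyPotential n p z - V z| ≤ κ) :
    |(p.roots.map ψ).sum / n - (2 * π)⁻¹ * ∫ z, ψ z ∂ν| ≤ B * κ := by
  have hψ2 : ContDiff ℝ 2 ψ := hψ.of_le (by norm_cast)
  have hB0 : 0 ≤ B := (abs_nonneg _).trans (hB 0)
  have hu := locallyIntegrable_polyPotential n p
  have e : (p.roots.map ψ).sum / n - (2 * π)⁻¹ * ∫ z, ψ z ∂ν =
      (2 * π)⁻¹ * ∫ z, (polyPotential n p z - V z) * Laplacian.laplacian ψ z := by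
    simp only [sub_mul]
    rw [integral_sub (integrable_mul_laplacian hu hψ2 hψc)
      (integrable_mul_laplacian hν.locallyIntegrable hψ2 hψc),
      integral_polyPotential_mul_laplacian n p hψ2 hψc, hν.integral_eq ψ hψ hψc, mul_sub,
      inv_mul_cancel_left₀ two_pi_pos.ne']
  have hint : IntegrableOn (fun z => |polyPotential n p z - V z|) (ball 0 R) :=
    (((hu.sub hν.locallyIntegrable).integrableOn_isCompact (isCompact_closedBall 0 R)).mono_set
      ball_subset_closedBall).norm
  have h1 : |∫ z, (polyPotential n p z - V z) * Laplacian.laplacian ψ z| ≤ B * κ := by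
    have hsub : ∫ z, (polyPotential n p z - V z) * Laplacian.laplacian ψ z =
        ∫ z in ball (0 : ℂ) R, (polyPotential n p z - V z) * Laplacian.laplacian ψ z := by
      refine (setIntegral_eq_integral_of_forall_compl_eq_zero fun z hz => ?_).symm
      rw [laplacian_eq_zero_of_notMem_tsupport fun h => hz (hR h), mul_zero]
    rw [hsub]
    calc _ ≤ ∫ z in ball (0 : ℂ) R, B * |polyPotential n p z - V z| := by
          rw [← Real.norm_eq_abs]
          refine norm_integral_le_of_norm_le (hint.const_mul B) (Eventually.of_forall fun z => ?_)
          rw [norm_mul, Real.norm_eq_abs, Real.norm_eq_abs, mul_comm]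
          exact mul_le_mul_of_nonneg_right (hB z) (abs_nonneg _)
      _ ≤ B * κ := by
          rw [integral_const_mul]
          gcongr
  rw [e, abs_mul, abs_of_pos (inv_pos.2 two_pi_pos)]
  have h2 : (2 * π)⁻¹ ≤ 1 := inv_le_one_of_one_le₀ (by linarith [pi_gt_three])
  exact (mul_le_of_le_one_left (abs_nonneg _) h2).trans h1

end CountingZeros

theorem theorem2p4
    (φ : ℂ → ℝ)
    (hφ_smooth : ContDiff ℝ 2 φ)
    (hφ_nonneg : ∀ z, 0 ≤ φ z)
    (hφ_radial : ∀ z : ℂ, φ z = φ (‖z‖ : ℂ))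
    (hφ_growth : ∃ δ : ℝ, 0 < δ ∧
      ∀ᶠ z in Bornology.cobounded ℂ, (1 + δ) * Real.log ‖z‖ ≤ φ z)
    (U : Set ℂ) (hU : Bornology.IsBounded U)
    (hU_frontier : MeasureTheory.volume (frontier U) = 0)
    (ε : ℝ) (hε : 0 < ε) :
    ∃ C : ℝ, 0 < C ∧ ∀ᶠ n : ℕ in Filter.atTop,
      RandomPoly.gaussianProb n
          {a | ε < |(RandomPoly.zeroCount (RandomPoly.randPoly φ n a) U : ℝ) / n
            - (RandomPoly.equilibriumMeasure φ).real U|}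
        ≤ ENNReal.ofReal (Real.exp (-C * n)) := by
  open MeasureTheory Filter Real Metric Set RandomPoly in
  have hφc := hφ_smooth.continuous
  obtain ⟨hν, hνv⟩ := laplacianMeasure_equilibriumPotential hφ_smooth hφ_nonneg hφ_radial hφ_growth
  set V := equilibriumPotential φ with hV
  set ν := laplacianMeasure V with hνdef
  have hVc : Continuous V := continuous_equilibriumPotential hφc hφ_nonneg hφ_radial
  have hV0 : ∀ z, 0 ≤ V z := equilibriumPotential_nonneg hφ_nonneg
  have hμ : equilibriumMeasure φ = ENNReal.ofReal (1 / (2 * π)) • ν := rfl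
  have hμint : ∀ ψ : ℂ → ℝ, ∫ z, ψ z ∂(equilibriumMeasure φ) = (2 * π)⁻¹ * ∫ z, ψ z ∂ν := by
    intro ψ
    rw [hμ, integral_smul_measure, ENNReal.toReal_ofReal (by positivity), smul_eq_mul, one_div]
  have hνf : IsLocallyFiniteMeasure ν := hν.locallyFinite
  have hμf : IsLocallyFiniteMeasure (equilibriumMeasure φ) := by
    refine ⟨fun z => ?_⟩
    obtain ⟨s, hs, hfin⟩ := hνf.finiteAtNhds z
    refine ⟨s, hs, ?_⟩
    rw [hμ, Measure.smul_apply, smul_eq_mul]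
    exact ENNReal.mul_lt_top ENNReal.ofReal_lt_top hfin
  have hfr : equilibriumMeasure φ (frontier U) = 0 := by
    rw [hμ, Measure.smul_apply, hνv hU_frontier, smul_zero]
  obtain ⟨ψ₁, ψ₂, ⟨a1, a2, a3, a4, a5⟩, b1, b2, b3, b4, b5⟩ :=
    exists_smooth_sandwich hU hfr (half_pos hε)
  obtain ⟨R, hR0, hR1, hR2⟩ : ∃ R : ℝ, 0 < R ∧ tsupport ψ₁ ⊆ ball 0 R ∧ tsupport ψ₂ ⊆ ball 0 R := by
    obtain ⟨R, hR⟩ := (a2.isCompact.isBounded.union b2.isCompact.isBounded).subset_ball 0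
    have h : ball (0 : ℂ) R ⊆ ball 0 (max R 1) := ball_subset_ball (le_max_left _ _)
    exact ⟨max R 1, by positivity, (subset_union_left.trans hR).trans h,
      (subset_union_right.trans hR).trans h⟩
  obtain ⟨B, hB1, hB2⟩ : ∃ B : ℝ, (∀ z, |Laplacian.laplacian ψ₁ z| ≤ B) ∧
      ∀ z, |Laplacian.laplacian ψ₂ z| ≤ B := by
    obtain ⟨B1, hB1⟩ := (continuous_laplacian (a1.of_le (by norm_cast) : ContDiff ℝ 2 ψ₁))
      |>.bounded_above_of_compact_support (hasCompactSupport_laplacian a2)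
    obtain ⟨B2, hB2⟩ := (continuous_laplacian (b1.of_le (by norm_cast) : ContDiff ℝ 2 ψ₂))
      |>.bounded_above_of_compact_support (hasCompactSupport_laplacian b2)
    exact ⟨max B1 B2, fun z => (hB1 z).trans (le_max_left _ _),
      fun z => (hB2 z).trans (le_max_right _ _)⟩
  have hB0 : 0 ≤ B := (abs_nonneg _).trans (hB1 0)
  obtain ⟨η, hη, Z, hZ⟩ := exists_grid hVc hR0 (κ := ε / (2 * (B + 1))) (by positivity)
  refine ⟨η / 4, by positivity, ?_⟩
  filter_upwards [eventually_gaussianProb_compl_le hφc hφ_nonneg hφ_radial hφ_growth hη Z,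
    eventually_ne_atTop 0] with n hn hn0
  refine (measure_mono fun a ha hgood => ?_).trans hn
  obtain ⟨hup, hlow⟩ := hgood
  change ε < _ at ha
  refine absurd ha (not_lt.2 ?_)
  set p := randPoly φ n a with hp
  have hn' : (0 : ℝ) < n := by exact_mod_cast Nat.pos_of_ne_zero hn0
  have hupa : ∀ᵐ z, polyPotential n p z ≤ V z + η := by
    rcases eq_or_ne p 0 with h0 | h0
    · refine Eventually.of_forall fun z => ?_
      have : polyPotential n p z = 0 := by simp [polyPotential, logPotential, h0]
      rw [this]
      linarith [hV0 z]
    · have hfin : {z | p.eval z = 0}.Finite := by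
        refine (p.roots.toFinset.finite_toSet).subset fun z hz => ?_
        simpa [h0] using hz
      filter_upwards [compl_mem_ae_iff.2 (hfin.measure_zero volume)] with z hz
      have hz : p.eval z ≠ 0 := hz
      rw [polyPotential_eq hz, div_le_iff₀ hn', mul_comm]
      exact (log_le_iff_le_exp (norm_pos_iff.2 hz)).2 (hup z)
  have hne : ∀ c ∈ Z, p.eval c ≠ 0 := fun c hc =>
    norm_pos_iff.1 ((exp_pos _).trans_le (hlow c hc))
  have hlowa : ∀ c ∈ Z, V c - η ≤ polyPotential n p c := by
    intro c hc
    rw [polyPotential_eq (hne c hc), le_div_iff₀ hn', mul_comm]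
    exact (le_log_iff_exp_le (norm_pos_iff.2 (hne c hc))).2 (hlow c hc)
  have hclose := hZ (polyPotential n p) (locallyIntegrable_polyPotential n p) hupa hlowa
    fun c hc ρ => mul_polyPotential_le_setIntegral_ball n (hne c hc) ρ
  have hBκ : B * (ε / (2 * (B + 1))) ≤ ε / 2 := by
    rw [mul_div_assoc', div_le_div_iff₀ (by positivity) two_pos]
    nlinarith
  have h1 := (abs_sum_roots_sub_le hν a1 a2 hR1 hB1 hclose).trans hBκ
  have h2 := (abs_sum_roots_sub_le hν b1 b2 hR2 hB2 hclose).trans hBκ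
  rw [← hμint] at h1 h2
  have h3 : (p.roots.map ψ₁).sum / n ≤ (zeroCount p U : ℝ) / n := by
    gcongr
    exact sum_le_zeroCount a3 a4
  have h4 : (zeroCount p U : ℝ) / n ≤ (p.roots.map ψ₂).sum / n := by
    gcongr
    exact zeroCount_le_sum b3 b4
  rw [abs_le] at h1 h2 ⊢
  constructor <;> linarith [h1.1, h2.2]
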